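/- Let $\mathbb{D}$ be the open unit disk with the hyperbolic metric $\sigma^2|dz|^2$, $\sigma(z)=2/(1-|z|^2)$, as a model of $\mathbb{H}^2$, and give $\mathbb{H}^2\times\mathbb{R}$ the product metric $\sigma^2|dz|^2+dt^2$. For a map $X=(h,f):\mathbb{D}\to\mathbb{H}^2\times\mathbb{R}$ let $Q(h)=(\sigma\circ h)^2\,h_w\,\bar h_w\,dw^2$ be its Hopf differential. Two conformal minimal immersions $X=(h,f)$ and $X^*=(h^*,f^*)$ of $\mathbb{D}$ are called associate if they induce the same metric on $\mathbb{D}$ and $Q(h^*)=e^{2i\theta}Q(h)$ for some $\theta\in\mathbb{R}$. Let $d>0$ and put, for $s,\tau\in\mathbb{R}$, $$U(s)=\sqrt{1+d^2}\,\cosh s,\qquad \rho(s)=\operatorname{arcosh}U(s),$$ $$\lambda(s)=d\int_0^s\frac{U(x)}{U(x)^2-1}\,dx,\qquad \varphi(s,\tau)=\tau-d\int_0^s\frac{dx}{U(x)\,(U(x)^2-1)},$$ $$T(s,\tau)=\bigl(\tanh(\rho(s)/2)\cos\varphi(s,\tau),\ \tanh(\rho(s)/2)\sin\varphi(s,\tau),\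 \lambda(s)+\varphi(s,\tau)\bigr).$$ 1. $T:\mathbb{R}^2\to\mathbb{H}^2\times\mathbb{R}$ is a smooth minimal embedding (an immersion that is a homeomorphism onto its image). Its induced metric is $ds^2+U(s)^2d\tau^2$, which has constant Gauss curvature $K\equiv-1$, and $T(\mathbb{R}^2)$ is invariant under the screw motions $(z,t)\mapsto(e^{i\alpha}z,\,t+\alpha)$, $\alpha\in\mathbb{R}$. 2. The slice $Y:\mathbb{D}\to\mathbb{H}^2\times\mathbb{R}$, $Y(z)=(z,0)$, is a conformal minimal immersion whose induced metric is complete with $K\equiv-1$. The vertical component of its unit normal is everywhere $\pm1$. 3. There is an injective conformal minimal immersion $X:\mathbb{D}\to\mathbb{H}^2\times\mathbb{R}$ with $X(\mathbb{D})=T(\mathbb{R}^2)$ whose induced metric is the hyperbolic metric $\sigma^2|dw|^2$ (so it is complete with $K\equiv-1$) and whose unit normal never has vertical component $\pm1$. The immersions $X$ and $Y$ are isometric, that is, they induce the same metric on $\mathbb{D}$, but they are not associate. -/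

import Mathlib

open scoped ContDiff

noncomputable section

namespace HypProd

/-- The open unit disk, the underlying set of the Poincare model of the hyperbolic plane. -/
def disk : Set ℂ := Metric.ball 0 1

/-- The conformal factor: the hyperbolic metric on the disk is `σ(z)² |dz|²`. -/
def sigma (z : ℂ) : ℝ := 2 / (1 - ‖z‖ ^ 2)

/-- The Riemannian metric `σ(z)² |dz|² + dt²` of the product of the hyperbolic plane and the line,
at the point `p = (z, t)`. -/
def metric (p v w : ℂ × ℝ) : ℝ := sigma p.1 ^ 2 * inner ℝ v.1 w.1 + v.2 * w.2

/-- Directional derivative; the direction `1` is `∂/∂u` and the direction `I` is `∂/∂v`, for the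
coordinate `w = u + i v`. -/
def pd {V : Type*} [NormedAddCommGroup V] [NormedSpace ℝ V] (a : ℂ) (F : ℂ → V) (w : ℂ) : V :=
  fderiv ℝ F w a

/-- The Wirtinger derivative `F_w = (F_u - i F_v) / 2`. -/
def dW (F : ℂ → ℂ) (w : ℂ) : ℂ := (1 / 2) * (pd 1 F w - Complex.I * pd Complex.I F w)

/-! ### First fundamental form -/

/-- The metric induced by `X` on the parameter domain, at `w`, on the tangent vectors `a`, `b`. -/
def induced (X : ℂ → ℂ × ℝ) (w a b : ℂ) : ℝ := metric (X w) (pd a X w) (pd b X w)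

/-- The coefficient `E` of the first fundamental form `E du² + 2 F du dv + G dv²`. -/
def coeffE (X : ℂ → ℂ × ℝ) (w : ℂ) : ℝ := induced X w 1 1

/-- The coefficient `F` of the first fundamental form. -/
def coeffF (X : ℂ → ℂ × ℝ) (w : ℂ) : ℝ := induced X w 1 Complex.I

/-- The coefficient `G` of the first fundamental form. -/
def coeffG (X : ℂ → ℂ × ℝ) (w : ℂ) : ℝ := induced X w Complex.I Complex.I

/-- `X` is a smooth immersion of `Ω` into the product of the hyperbolic disk and the line. -/
def IsImmersionOn (Ω : Set ℂ) (X : ℂ → ℂ × ℝ) : Prop :=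
  ContDiffOn ℝ ∞ X Ω ∧ (∀ w ∈ Ω, (X w).1 ∈ disk) ∧
    ∀ w ∈ Ω, Function.Injective (fderiv ℝ X w)

/-- The induced metric is a multiple of `|dw|²`. -/
def IsConformalOn (Ω : Set ℂ) (X : ℂ → ℂ × ℝ) : Prop :=
  ∀ w ∈ Ω, coeffE X w = coeffG X w ∧ coeffF X w = 0

/-- `X` and `Y` induce the same metric on `Ω`. -/
def AreIsometricOn (Ω : Set ℂ) (X Y : ℂ → ℂ × ℝ) : Prop :=
  ∀ w ∈ Ω, coeffE X w = coeffE Y w ∧ coeffF X w = coeffF Y w ∧ coeffG X w = coeffG Y w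

/-- The intrinsic (Gauss) curvature of the metric induced by `X`, by Brioschi's formula. -/
def gaussCurvature (X : ℂ → ℂ × ℝ) (w : ℂ) : ℝ :=
  let E := coeffE X
  let F := coeffF X
  let G := coeffG X
  let du : (ℂ → ℝ) → ℂ → ℝ := pd 1
  let dv : (ℂ → ℝ) → ℂ → ℝ := pd Complex.I
  ((!![-(1 / 2) * dv (dv E) w + du (dv F) w - (1 / 2) * du (du G) w,
        (1 / 2) * du E w, du F w - (1 / 2) * dv E w;
        dv F w - (1 / 2) * du G w, E w, F w;
        (1 / 2) * dv G w, F w, G w] : Matrix (Fin 3) (Fin 3) ℝ).det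
    - (!![0, (1 / 2) * dv E w, (1 / 2) * du G w;
        (1 / 2) * dv E w, E w, F w;
        (1 / 2) * du G w, F w, G w] : Matrix (Fin 3) (Fin 3) ℝ).det)
    / (E w * G w - F w ^ 2) ^ 2

/-- The length of the curve `γ` (over the unit interval) for the metric induced by `X`. -/
def inducedLength (X : ℂ → ℂ × ℝ) (γ : ℝ → ℂ) : ENNReal :=
  ∫⁻ t in Set.Icc (0 : ℝ) 1,
    ENNReal.ofReal (Real.sqrt (induced X (γ t) (deriv γ t) (deriv γ t)))

/-- The Riemannian distance of the metric induced by `X` on `Ω`: the infimum of the lengths of the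
continuously differentiable curves in `Ω` from `p` to `q`. -/
def inducedDist (Ω : Set ℂ) (X : ℂ → ℂ × ℝ) (p q : ℂ) : ENNReal :=
  ⨅ γ : {γ : ℝ → ℂ // ContDiff ℝ 1 γ ∧ γ 0 = p ∧ γ 1 = q ∧ ∀ t ∈ Set.Icc (0 : ℝ) 1, γ t ∈ Ω},
    inducedLength X γ.1

/-- `Ω` is complete for the Riemannian distance of the metric induced by `X`. -/
def IsCompleteOn (Ω : Set ℂ) (X : ℂ → ℂ × ℝ) : Prop :=
  ∀ p : ℕ → ℂ, (∀ n, p n ∈ Ω) →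
    (∀ ε : ENNReal, 0 < ε → ∃ N, ∀ m ≥ N, ∀ n ≥ N, inducedDist Ω X (p m) (p n) < ε) →
    ∃ q ∈ Ω, Filter.Tendsto (fun n => inducedDist Ω X (p n) q) Filter.atTop (nhds 0)

/-! ### Normal vectors, second fundamental form, minimality -/

/-- `n` is orthogonal to the surface `X` at the parameter `w`. -/
def IsNormalTo (X : ℂ → ℂ × ℝ) (w : ℂ) (n : ℂ × ℝ) : Prop :=
  ∀ a : ℂ, metric (X w) n (pd a X w) = 0

/-- `n` is one of the two unit normal vectors of the surface `X` at the parameter `w`; its vertical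
component is `n.2`. -/
def IsUnitNormal (X : ℂ → ℂ × ℝ) (w : ℂ) (n : ℂ × ℝ) : Prop :=
  IsNormalTo X w n ∧ metric (X w) n n = 1

/-- The covariant derivative (Levi-Civita connection of the product metric) along `X`, in the
direction `a`, of the vector field `pd b X`. The only nonzero Christoffel symbol of `σ² |dz|²` in the
complex coordinate `z`, up to conjugation, is `2 (log σ)_z`. -/
def covDeriv (X : ℂ → ℂ × ℝ) (a b w : ℂ) : ℂ × ℝ :=
  let h : ℂ → ℂ := fun p => (X p).1
  let f : ℂ → ℝ := fun p => (X p).2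
  (pd a (pd b h) w +
      2 * dW (fun z => (Real.log (sigma z) : ℂ)) (h w) * pd a h w * pd b h w,
    pd a (pd b f) w)

/-- The mean curvature of the immersion `X` in the normal direction `n`. -/
def meanCurvature (X : ℂ → ℂ × ℝ) (w : ℂ) (n : ℂ × ℝ) : ℝ :=
  (coeffG X w * metric (X w) (covDeriv X 1 1 w) n
      - 2 * coeffF X w * metric (X w) (covDeriv X 1 Complex.I w) n
      + coeffE X w * metric (X w) (covDeriv X Complex.I Complex.I w) n)
    / (2 * (coeffE X w * coeffG X w - coeffF X w ^ 2))

/-- The mean curvature vector of `X` vanishes on `Ω`. -/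
def IsMinimalOn (Ω : Set ℂ) (X : ℂ → ℂ × ℝ) : Prop :=
  ∀ w ∈ Ω, ∀ n, IsNormalTo X w n → meanCurvature X w n = 0

/-- Conformal minimal immersions of `Ω` into the product. -/
def IsConformalMinimalImmersionOn (Ω : Set ℂ) (X : ℂ → ℂ × ℝ) : Prop :=
  IsImmersionOn Ω X ∧ IsConformalOn Ω X ∧ IsMinimalOn Ω X

/-! ### Hopf function, associate immersions -/

/-- The coefficient `φ = (σ ∘ h)² h_w (h̄)_w` of the Hopf differential `Q(h) = φ dw²`. -/
def hopf (h : ℂ → ℂ) (w : ℂ) : ℂ :=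
  (sigma (h w) : ℂ) ^ 2 * dW h w * dW (fun p => starRingEnd ℂ (h p)) w

/-- Associate immersions: isometric, and `Q(h*) = e^{2iθ} Q(h)` for some real `θ`. -/
def AreAssociateOn (Ω : Set ℂ) (X Y : ℂ → ℂ × ℝ) : Prop :=
  AreIsometricOn Ω X Y ∧
    ∃ θ : ℝ, ∀ w ∈ Ω, hopf (fun p => (Y p).1) w =
      Complex.exp (2 * Complex.I * (θ : ℂ)) * hopf (fun p => (X p).1) w

/-! ### The two surfaces -/

/-- The slice `z ↦ (z, 0)`. -/
def slice (z : ℂ) : ℂ × ℝ := (z, 0)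

/-- The screw motion of pitch `ℓ`: rotation by the angle `α` followed by the vertical translation
by `ℓ α`. -/
def screwMotion (ℓ α : ℝ) (p : ℂ × ℝ) : ℂ × ℝ :=
  (Complex.exp ((α : ℂ) * Complex.I) * p.1, p.2 + ℓ * α)

/-- `U(s) = √(1 + d²) cosh s`. -/
def screwU (d s : ℝ) : ℝ := Real.sqrt (1 + d ^ 2) * Real.cosh s

/-- `ρ(s) = arcosh U(s)`. -/
def screwRho (d s : ℝ) : ℝ := Real.arcosh (screwU d s)

/-- `λ(ρ(s)) = d ∫ U / (U² - 1) ds`, the primitive that vanishes at `0`. -/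
def screwLambda (d s : ℝ) : ℝ := d * ∫ x in (0 : ℝ)..s, screwU d x / (screwU d x ^ 2 - 1)

/-- `φ(s, τ) = τ - d ∫ 1 / (U (U² - 1)) ds`, with the primitive that vanishes at `0`. -/
def screwPhi (d s τ : ℝ) : ℝ :=
  τ - d * ∫ x in (0 : ℝ)..s, 1 / (screwU d x * (screwU d x ^ 2 - 1))

/-- The screw motion surface `T(s, τ) = (tanh(ρ/2) cos φ, tanh(ρ/2) sin φ, λ + φ)`, with the
parameter plane written in the complex variable `s + i τ`. -/
def screwSurface (d : ℝ) (w : ℂ) : ℂ × ℝ :=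
  (⟨Real.tanh (screwRho d w.re / 2) * Real.cos (screwPhi d w.re w.im),
    Real.tanh (screwRho d w.re / 2) * Real.sin (screwPhi d w.re w.im)⟩,
   screwLambda d w.re + screwPhi d w.re w.im)

end HypProd

end

noncomputable section

namespace HypProd

open Complex Filter Topology

/-! ### Directional derivatives and the ambient metric -/

lemma isOpen_disk : IsOpen disk := Metric.isOpen_ball

lemma mem_disk_iff {z : ℂ} : z ∈ disk ↔ ‖z‖ < 1 := by simp [disk]

lemma one_sub_norm_sq_pos {z : ℂ} (hz : z ∈ disk) : 0 < 1 - ‖z‖ ^ 2 := by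
  have h := mem_disk_iff.1 hz
  nlinarith [norm_nonneg z]

lemma sigma_pos {z : ℂ} (hz : z ∈ disk) : 0 < sigma z :=
  div_pos two_pos (one_sub_norm_sq_pos hz)

lemma pd_eq {V : Type*} [NormedAddCommGroup V] [NormedSpace ℝ V] (v : ℂ) (F : ℂ → V) (w : ℂ) :
    pd v F w = v.re • pd 1 F w + v.im • pd I F w := by
  unfold pd
  rw [← map_smul, ← map_smul, ← map_add]
  congr 1
  apply Complex.ext <;> simp

lemma pd_comp {V : Type*} [NormedAddCommGroup V] [NormedSpace ℝ V] {F : ℂ → V} {Φ : ℂ → ℂ} {w : ℂ}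
    (hF : DifferentiableAt ℝ F (Φ w)) (hΦ : DifferentiableAt ℝ Φ w) (a : ℂ) :
    pd a (F ∘ Φ) w = pd (pd a Φ w) F (Φ w) := by
  simp [pd, fderiv_comp w hF hΦ]

lemma metric_eq (p v w : ℂ × ℝ) :
    metric p v w = sigma p.1 ^ 2 * (v.1.re * w.1.re + v.1.im * w.1.im) + v.2 * w.2 := by
  simp only [metric, Complex.inner, Complex.mul_re, Complex.conj_re, Complex.conj_im]
  ring

lemma induced_comp {P : ℂ → ℂ × ℝ} {Φ : ℂ → ℂ} {w : ℂ} (hP : DifferentiableAt ℝ P (Φ w))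
    (hΦ : DifferentiableAt ℝ Φ w) (a b : ℂ) :
    induced (P ∘ Φ) w a b = induced P (Φ w) (pd a Φ w) (pd b Φ w) := by
  simp only [induced, pd_comp hP hΦ, Function.comp_apply]

lemma injective_fderiv_of_induced_pos {X : ℂ → ℂ × ℝ} {w : ℂ}
    (h : ∀ v : ℂ, v ≠ 0 → 0 < induced X w v v) : Function.Injective (fderiv ℝ X w) := by
  rw [injective_iff_map_eq_zero]
  intro v hv
  by_contra hne
  have := h v hne
  simp [induced, pd, hv, metric_eq] at this

/-! ### Second derivatives of a reparametrized map -/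

lemma pd_pd_eq {V : Type*} [NormedAddCommGroup V] [NormedSpace ℝ V] {F : ℂ → V} {w : ℂ}
    (hF : ContDiffAt ℝ 2 F w) (a b : ℂ) : pd a (pd b F) w = fderiv ℝ (fderiv ℝ F) w a b := by
  have h : DifferentiableAt ℝ (fderiv ℝ F) w :=
    (hF.fderiv_right (m := 1) (by norm_num)).differentiableAt (by norm_num)
  have h2 : HasFDerivAt (pd b F) ((fderiv ℝ (fderiv ℝ F) w).flip b) w := by
    change HasFDerivAt (fun p => fderiv ℝ F p b) _ w
    simpa using h.hasFDerivAt.clm_apply (hasFDerivAt_const b w)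
  rw [pd, h2.fderiv]
  rfl

lemma pd_pd_comp {V : Type*} [NormedAddCommGroup V] [NormedSpace ℝ V] {F : ℂ → V} {Φ : ℂ → ℂ}
    {w : ℂ} (hF : ContDiffAt ℝ 2 F (Φ w)) (hΦ : ContDiffAt ℝ 2 Φ w) (a b : ℂ) :
    pd a (pd b (F ∘ Φ)) w =
      pd (pd a Φ w) (pd (pd b Φ w) F) (Φ w) + pd (pd a (pd b Φ) w) F (Φ w) := by
  have hF' : DifferentiableAt ℝ (fderiv ℝ F) (Φ w) :=
    (hF.fderiv_right (m := 1) (by norm_num)).differentiableAt (by norm_num)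
  have hΦ' : DifferentiableAt ℝ (fderiv ℝ Φ) w :=
    (hΦ.fderiv_right (m := 1) (by norm_num)).differentiableAt (by norm_num)
  have hΦd : DifferentiableAt ℝ Φ w := hΦ.differentiableAt (by norm_num)
  have hev : pd b (F ∘ Φ) =ᶠ[𝓝 w] fun p => fderiv ℝ F (Φ p) (fderiv ℝ Φ p b) := by
    have h1 := hΦ.eventually (by simp)
    have h2 := hΦ.continuousAt.eventually (hF.eventually (by simp))
    filter_upwards [h1, h2] with p hp1 hp2
    exact pd_comp (hp2.differentiableAt (by norm_num)) (hp1.differentiableAt (by norm_num)) b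
  have hd : HasFDerivAt (fun p => fderiv ℝ Φ p b) ((fderiv ℝ (fderiv ℝ Φ) w).flip b) w := by
    simpa using hΦ'.hasFDerivAt.clm_apply (hasFDerivAt_const b w)
  have h3 := (hF'.hasFDerivAt.comp w hΦd.hasFDerivAt).clm_apply hd
  have h4 : fderiv ℝ (pd b (F ∘ Φ)) w = _ := hev.fderiv_eq.trans h3.fderiv
  rw [pd, h4, pd_pd_eq hF, pd_pd_eq hΦ]
  simp [pd, add_comm]

lemma fst_comp {P : ℂ → ℂ × ℝ} {w : ℂ} (hP : DifferentiableAt ℝ P w) (a : ℂ) :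
    (pd a P w).1 = pd a (fun p => (P p).1) w := by
  have := hP.hasFDerivAt.fst.fderiv
  simp [pd, this]

lemma snd_comp {P : ℂ → ℂ × ℝ} {w : ℂ} (hP : DifferentiableAt ℝ P w) (a : ℂ) :
    (pd a P w).2 = pd a (fun p => (P p).2) w := by
  have := hP.hasFDerivAt.snd.fderiv
  simp [pd, this]

lemma covDeriv_comp {P : ℂ → ℂ × ℝ} {Φ : ℂ → ℂ} {w : ℂ} (hP : ContDiffAt ℝ 2 P (Φ w))
    (hΦ : ContDiffAt ℝ 2 Φ w) (a b : ℂ) :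
    covDeriv (P ∘ Φ) a b w =
      covDeriv P (pd a Φ w) (pd b Φ w) (Φ w) + pd (pd a (pd b Φ) w) P (Φ w) := by
  have h1 : (fun p => ((P ∘ Φ) p).1) = (fun p => (P p).1) ∘ Φ := rfl
  have h2 : (fun p => ((P ∘ Φ) p).2) = (fun p => (P p).2) ∘ Φ := rfl
  have hPd := hP.differentiableAt (by norm_num : (2 : WithTop ℕ∞) ≠ 0)
  have hΦd := hΦ.differentiableAt (by norm_num : (2 : WithTop ℕ∞) ≠ 0)
  refine Prod.ext ?_ ?_
  · simp only [covDeriv, Prod.fst_add, fst_comp hPd]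
    rw [h1, pd_pd_comp hP.fst hΦ, pd_comp hPd.fst hΦd, pd_comp hPd.fst hΦd]
    simp only [Function.comp_apply]
    ring
  · simp only [covDeriv, Prod.snd_add, snd_comp hPd]
    rw [h2, pd_pd_comp hP.snd hΦ]

lemma pd_pd_expand {V : Type*} [NormedAddCommGroup V] [NormedSpace ℝ V] {F : ℂ → V} {w : ℂ}
    (hF : ContDiffAt ℝ 2 F w) (a b : ℂ) :
    pd a (pd b F) w = (a.re * b.re) • pd 1 (pd 1 F) w + (a.re * b.im) • pd 1 (pd I F) w +
      (a.im * b.re) • pd I (pd 1 F) w + (a.im * b.im) • pd I (pd I F) w := by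
  have key : ∀ v : ℂ, v = v.re • (1 : ℂ) + v.im • I := fun v => by apply Complex.ext <;> simp
  simp only [pd_pd_eq hF]
  conv_lhs => rw [key a, key b]
  simp only [map_add, map_smul, add_apply, smul_apply,
    smul_add, smul_smul]
  rw [mul_comm b.re, mul_comm b.im, mul_comm b.re, mul_comm b.im]
  abel

lemma covDeriv_expand {P : ℂ → ℂ × ℝ} {w : ℂ} (hP : ContDiffAt ℝ 2 P w) (a b : ℂ) :
    covDeriv P a b w = (a.re * b.re) • covDeriv P 1 1 w + (a.re * b.im) • covDeriv P 1 I w +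
      (a.im * b.re) • covDeriv P I 1 w + (a.im * b.im) • covDeriv P I I w := by
  refine Prod.ext ?_ ?_
  · simp only [covDeriv, Prod.fst_add, Prod.smul_fst]
    rw [pd_pd_expand hP.fst a b, pd_eq a, pd_eq b]
    simp only [Complex.real_smul]
    push_cast
    ring
  · simp only [covDeriv, Prod.snd_add, Prod.smul_snd]
    rw [pd_pd_expand hP.snd a b]

/-- A reparametrization of a harmonic surface is minimal as soon as it is trace-compatible with its
own first fundamental form. -/
lemma isMinimalOn_comp {Ω : Set ℂ} {P : ℂ → ℂ × ℝ} {Φ : ℂ → ℂ} (hP : ContDiff ℝ 2 P)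
    (hΦ : ∀ w ∈ Ω, ContDiffAt ℝ 2 Φ w)
    (hharm : ∀ w ∈ Ω, covDeriv P 1 1 (Φ w) + covDeriv P I I (Φ w) = 0)
    (hsurj : ∀ w ∈ Ω, Function.Surjective (fderiv ℝ Φ w))
    (hF : ∀ w ∈ Ω, coeffF (P ∘ Φ) w = 0)
    (hdiag : ∀ w ∈ Ω, coeffG (P ∘ Φ) w * (pd 1 Φ w).re ^ 2 + coeffE (P ∘ Φ) w * (pd I Φ w).re ^ 2 =
      coeffG (P ∘ Φ) w * (pd 1 Φ w).im ^ 2 + coeffE (P ∘ Φ) w * (pd I Φ w).im ^ 2)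
    (hoff : ∀ w ∈ Ω, coeffG (P ∘ Φ) w * ((pd 1 Φ w).re * (pd 1 Φ w).im) +
      coeffE (P ∘ Φ) w * ((pd I Φ w).re * (pd I Φ w).im) = 0) :
    IsMinimalOn Ω (P ∘ Φ) := by
  intro w hw n hn
  have hn' : ∀ v, metric (P (Φ w)) n (pd v P (Φ w)) = 0 := by
    intro v
    obtain ⟨a, rfl⟩ := hsurj w hw v
    have := hn a
    rwa [pd_comp ((hP.differentiable (by norm_num)) _)
      ((hΦ w hw).differentiableAt (by norm_num))] at this
  have hh := hharm w hw
  unfold meanCurvature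
  rw [hF w hw, covDeriv_comp hP.contDiffAt (hΦ w hw), covDeriv_comp hP.contDiffAt (hΦ w hw) I I,
    covDeriv_expand hP.contDiffAt (pd 1 Φ w) (pd 1 Φ w),
    covDeriv_expand hP.contDiffAt (pd I Φ w) (pd I Φ w), eq_neg_of_add_eq_zero_left hh]
  have n1 := hn' (pd 1 (pd 1 Φ) w)
  have n2 := hn' (pd I (pd I Φ) w)
  have hd := hdiag w hw
  have ho := hoff w hw
  rw [div_eq_zero_iff]
  left
  simp only [Function.comp_apply]
  generalize coeffG (P ∘ Φ) w = G at *
  generalize coeffE (P ∘ Φ) w = E at *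
  simp only [metric_eq, Prod.fst_add, Prod.snd_add, Prod.smul_fst, Prod.smul_snd, Complex.add_re,
    Complex.add_im, Complex.real_smul, Complex.re_ofReal_mul, Complex.im_ofReal_mul, smul_eq_mul,
    Prod.fst_neg, Prod.snd_neg, Complex.neg_re, Complex.neg_im] at n1 n2 ⊢
  generalize pd 1 Φ w = α at *
  generalize pd I Φ w = β at *
  generalize covDeriv P I I (Φ w) = c1 at *
  generalize covDeriv P I 1 (Φ w) = c2 at *
  generalize covDeriv P 1 I (Φ w) = c3 at *
  linear_combination G * n1 + E * n2 -
    (sigma (P (Φ w)).1 ^ 2 * (c1.1.re * n.1.re + c1.1.im * n.1.im) + c1.2 * n.2) * hd +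
    (sigma (P (Φ w)).1 ^ 2 * ((c2.1.re + c3.1.re) * n.1.re + (c2.1.im + c3.1.im) * n.1.im) +
      (c2.2 + c3.2) * n.2) * ho

/-- The Wirtinger derivative of `log σ`, which gives the Christoffel symbol. -/
lemma dW_log_sigma {z : ℂ} (hz : z ∈ disk) :
    dW (fun z => (Real.log (sigma z) : ℂ)) z = starRingEnd ℂ z / ((1 - ‖z‖ ^ 2 : ℝ) : ℂ) := by
  have hpos := one_sub_norm_sq_pos hz
  have hev : (fun z => (Real.log (sigma z) : ℂ)) =ᶠ[𝓝 z]
      fun z => ((Real.log 2 - Real.log (1 - ‖z‖ ^ 2) : ℝ) : ℂ) := by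
    filter_upwards [isOpen_disk.mem_nhds hz] with p hp
    rw [sigma, Real.log_div two_ne_zero (one_sub_norm_sq_pos hp).ne']
  have h1 : HasFDerivAt (fun z : ℂ => Real.log 2 - Real.log (1 - ‖z‖ ^ 2))
      (-((1 - ‖z‖ ^ 2)⁻¹ • (-((2 : ℝ) • innerSL ℝ z)))) z := by
    have := (((hasStrictFDerivAt_norm_sq z).hasFDerivAt.const_sub 1).log hpos.ne').const_sub
      (Real.log 2)
    refine this.congr_fderiv ?_
    ext a
    simp
    exact Or.inl (by ring)
  have h2 := Complex.ofRealCLM.hasFDerivAt.comp z h1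
  have h3 : ∀ a, pd a (fun z => (Real.log (sigma z) : ℂ)) z =
      (((1 - ‖z‖ ^ 2)⁻¹ * (2 * inner ℝ z a) : ℝ) : ℂ) := by
    intro a
    have h4 : fderiv ℝ (fun z => (Real.log (sigma z) : ℂ)) z = _ := hev.fderiv_eq.trans h2.fderiv
    rw [pd, h4]
    simp
    ring
  rw [dW, h3, h3]
  apply Complex.ext <;> simp [Complex.inner, div_eq_mul_inv, ← Complex.ofReal_inv,
    -Complex.ofReal_pow, -Complex.ofReal_one, -Complex.ofReal_sub] <;> ring

/-- The constant `√(1 + d²)`. -/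
def screwB (d : ℝ) : ℝ := Real.sqrt (1 + d ^ 2)

lemma screwB_sq (d : ℝ) : screwB d ^ 2 = 1 + d ^ 2 := Real.sq_sqrt (by positivity)

lemma one_lt_screwB {d : ℝ} (hd : 0 < d) : 1 < screwB d := by
  rw [screwB, Real.lt_sqrt] <;> nlinarith

lemma cos_add_screwB_pos {d : ℝ} (hd : 0 < d) (y : ℝ) : 0 < Real.cos y + screwB d := by
  linarith [one_lt_screwB hd, Real.neg_one_le_cos y]

lemma hasDerivAt_mk {f g : ℝ → ℝ} {f' g' y : ℝ} (hf : HasDerivAt f f' y)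
    (hg : HasDerivAt g g' y) : HasDerivAt (fun y => (⟨f y, g y⟩ : ℂ)) ⟨f', g'⟩ y := by
  have h := hf.ofReal_comp.add (hg.ofReal_comp.mul_const I)
  rw [← Complex.mk_eq_add_mul_I] at h
  exact h.congr_of_eventuallyEq (Eventually.of_forall fun y => Complex.mk_eq_add_mul_I _ _)

/-! ### The conformal parametrization of the screw motion surface by a strip -/

/-- The height function of the strip parametrization. -/
def stripHeight (d : ℝ) (ζ : ℂ) : ℝ := (ζ.re + d * ζ.im) / screwB d

/-- A function with the helicoidal symmetry `F(ζ + α) = e^{iα/b} F(ζ)` for real `α`. -/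
def helix (d : ℝ) (κ : ℝ → ℂ) (ζ : ℂ) : ℂ := exp (stripHeight d ζ * I) * κ ζ.im

/-- The profile curve of the strip parametrization. -/
def profile (d y : ℝ) : ℂ :=
  ⟨d * Real.cos y / (Real.cos y + screwB d), -screwB d * Real.sin y / (Real.cos y + screwB d)⟩

/-- The first derivative of `profile`. -/
def profile' (d y : ℝ) : ℂ :=
  ⟨-screwB d * d * Real.sin y / (Real.cos y + screwB d) ^ 2,
    -screwB d * (1 + screwB d * Real.cos y) / (Real.cos y + screwB d) ^ 2⟩

/-- The second derivative of `profile`. -/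
def profile'' (d y : ℝ) : ℂ :=
  ⟨-screwB d * d * Real.cos y / (Real.cos y + screwB d) ^ 2 -
      2 * screwB d * d * Real.sin y ^ 2 / (Real.cos y + screwB d) ^ 3,
    screwB d ^ 2 * Real.sin y / (Real.cos y + screwB d) ^ 2 -
      2 * screwB d * (1 + screwB d * Real.cos y) * Real.sin y / (Real.cos y + screwB d) ^ 3⟩

/-- The conformal parametrization of the screw motion surface by the strip `|Im ζ| < π / 2`. -/
def stripMap (d : ℝ) (ζ : ℂ) : ℂ × ℝ := (helix d (profile d) ζ, stripHeight d ζ)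

lemma hasDerivAt_profile {d : ℝ} (hd : 0 < d) (y : ℝ) :
    HasDerivAt (profile d) (profile' d y) y := by
  have hD := (cos_add_screwB_pos hd y).ne'
  have hD' := (Real.hasDerivAt_cos y).add_const (screwB d)
  have hsc := Real.sin_sq_add_cos_sq y
  refine (hasDerivAt_mk (((Real.hasDerivAt_cos y).const_mul d).div hD' hD)
    (((Real.hasDerivAt_sin y).const_mul (-screwB d)).div hD' hD)).congr_deriv ?_
  apply Complex.ext
  · simp only [profile']
    congr 1
    ring
  · simp only [profile']
    congr 1
    linear_combination -screwB d * hsc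

lemma hasDerivAt_profile' {d : ℝ} (hd : 0 < d) (y : ℝ) :
    HasDerivAt (profile' d) (profile'' d y) y := by
  have hD := (cos_add_screwB_pos hd y).ne'
  have hD' := ((Real.hasDerivAt_cos y).add_const (screwB d)).pow 2
  refine (hasDerivAt_mk
    (((Real.hasDerivAt_sin y).const_mul (-screwB d * d)).div hD' (pow_ne_zero 2 hD))
    (((((Real.hasDerivAt_cos y).const_mul (screwB d)).const_add 1).const_mul (-screwB d)).div hD'
      (pow_ne_zero 2 hD))).congr_deriv ?_
  apply Complex.ext
  · simp only [profile'', Pi.pow_apply]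
    field_simp
    ring
  · simp only [profile'', Pi.pow_apply]
    field_simp
    ring

lemma coe_stripHeight (d : ℝ) :
    stripHeight d = ((screwB d)⁻¹ • (reCLM + d • imCLM) : ℂ →L[ℝ] ℝ) := by
  ext z
  simp [stripHeight, div_eq_inv_mul, mul_add]

lemma hasFDerivAt_stripHeight (d : ℝ) (ζ : ℂ) :
    HasFDerivAt (stripHeight d) ((screwB d)⁻¹ • (reCLM + d • imCLM)) ζ := by
  rw [coe_stripHeight]
  exact ContinuousLinearMap.hasFDerivAt _

lemma pd_stripHeight (d : ℝ) (a ζ : ℂ) : pd a (stripHeight d) ζ = stripHeight d a := by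
  simp [pd, (hasFDerivAt_stripHeight d ζ).fderiv, stripHeight, div_eq_inv_mul, mul_add]

lemma hasFDerivAt_helix {d : ℝ} {κ : ℝ → ℂ} {κ' : ℂ} {ζ : ℂ} (h : HasDerivAt κ κ' ζ.im) :
    HasFDerivAt (helix d κ)
      (exp (stripHeight d ζ * I) • (imCLM.smulRight κ') +
        κ ζ.im • (exp (stripHeight d ζ * I) •
          (((screwB d)⁻¹ • (reCLM + d • imCLM)).smulRight I))) ζ := by
  have h1 : HasFDerivAt (fun z => κ (imCLM z)) (imCLM.smulRight κ') ζ := by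
    refine (HasFDerivAt.comp ζ (g := κ) h.hasFDerivAt imCLM.hasFDerivAt).congr_fderiv ?_
    ext; simp
  have h2 : HasFDerivAt (fun z => ((stripHeight d z : ℝ) : ℂ) * I)
      (((screwB d)⁻¹ • (reCLM + d • imCLM)).smulRight I) ζ := by
    refine ((ofRealCLM.hasFDerivAt.comp ζ
      (hasFDerivAt_stripHeight d ζ)).mul_const I).congr_fderiv ?_
    ext; simp [mul_comm, mul_add]
  exact h2.cexp.mul h1

lemma pd_helix {d : ℝ} {κ : ℝ → ℂ} {κ' : ℂ} {ζ : ℂ} (h : HasDerivAt κ κ' ζ.im) (a : ℂ) :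
    pd a (helix d κ) ζ =
      exp (stripHeight d ζ * I) * (stripHeight d a * I * κ ζ.im + a.im * κ') := by
  rw [pd, (hasFDerivAt_helix h).fderiv]
  simp [stripHeight]
  ring

lemma pd_one_helix {d : ℝ} {κ κ' : ℝ → ℂ} (h : ∀ y, HasDerivAt κ (κ' y) y) :
    pd 1 (helix d κ) = helix d fun y => (screwB d : ℂ)⁻¹ * I * κ y := by
  ext ζ
  simp [pd_helix (h _), helix, stripHeight]

lemma pd_I_helix {d : ℝ} {κ κ' : ℝ → ℂ} (h : ∀ y, HasDerivAt κ (κ' y) y) :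
    pd I (helix d κ) = helix d fun y => (d / screwB d : ℂ) * I * κ y + κ' y := by
  ext ζ
  simp [pd_helix (h _), helix, stripHeight]

lemma contDiff_helix {d : ℝ} {κ : ℝ → ℂ} (h : ContDiff ℝ ∞ κ) : ContDiff ℝ ∞ (helix d κ) := by
  have h1 : ContDiff ℝ ∞ (stripHeight d) := by
    rw [coe_stripHeight]
    exact ContinuousLinearMap.contDiff _
  exact ((ofRealCLM.contDiff.comp h1).mul contDiff_const).cexp.mul (h.comp imCLM.contDiff)

lemma contDiff_profile {d : ℝ} (hd : 0 < d) : ContDiff ℝ ∞ (profile d) := by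
  have hD : ContDiff ℝ ∞ fun y => Real.cos y + screwB d := Real.contDiff_cos.add contDiff_const
  have h1 : ContDiff ℝ ∞ fun y => d * Real.cos y / (Real.cos y + screwB d) :=
    (contDiff_const.mul Real.contDiff_cos).div hD fun y => (cos_add_screwB_pos hd y).ne'
  have h2 : ContDiff ℝ ∞ fun y => -screwB d * Real.sin y / (Real.cos y + screwB d) :=
    (contDiff_const.mul Real.contDiff_sin).div hD fun y => (cos_add_screwB_pos hd y).ne'
  exact equivRealProdCLM.symm.contDiff.comp (h1.prodMk h2)

lemma contDiff_stripMap {d : ℝ} (hd : 0 < d) : ContDiff ℝ ∞ (stripMap d) := by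
  refine (contDiff_helix (contDiff_profile hd)).prodMk ?_
  rw [coe_stripHeight]
  exact ContinuousLinearMap.contDiff _

lemma one_sub_norm_helix_sq {d : ℝ} (hd : 0 < d) (ζ : ℂ) :
    1 - ‖helix d (profile d) ζ‖ ^ 2 = 2 * Real.cos ζ.im / (Real.cos ζ.im + screwB d) := by
  have hD := (cos_add_screwB_pos hd ζ.im).ne'
  have hsc := Real.sin_sq_add_cos_sq ζ.im
  have hb := screwB_sq d
  rw [helix, norm_mul, Complex.norm_exp_ofReal_mul_I, one_mul, Complex.sq_norm, normSq_apply,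
    profile]
  field_simp
  linear_combination Real.cos ζ.im ^ 2 * hb - screwB d ^ 2 * hsc

lemma helix_mem_disk {d : ℝ} (hd : 0 < d) {ζ : ℂ} (h : 0 < Real.cos ζ.im) :
    helix d (profile d) ζ ∈ disk := by
  have h1 := one_sub_norm_helix_sq hd ζ
  have h2 : 0 < 2 * Real.cos ζ.im / (Real.cos ζ.im + screwB d) :=
    div_pos (by linarith) (cos_add_screwB_pos hd _)
  rw [mem_disk_iff]
  nlinarith [norm_nonneg (helix d (profile d) ζ)]

lemma sigma_helix {d : ℝ} (hd : 0 < d) (ζ : ℂ) :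
    sigma (helix d (profile d) ζ) = (Real.cos ζ.im + screwB d) / Real.cos ζ.im := by
  rw [sigma, one_sub_norm_helix_sq hd]
  rw [div_div_eq_mul_div, mul_div_mul_left _ _ two_ne_zero]

lemma inner_exp_mul (t : ℝ) (u v : ℂ) :
    inner ℝ (exp (t * I) * u) (exp (t * I) * v) = inner ℝ u v := by
  have h : starRingEnd ℂ (exp (t * I)) * exp (t * I) = 1 := by
    rw [← Complex.exp_conj, ← Complex.exp_add]
    simp
  rw [Complex.inner, Complex.inner, map_mul]
  congr 1
  linear_combination starRingEnd ℂ u * v * h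

lemma pd_stripMap {d : ℝ} (hd : 0 < d) (a ζ : ℂ) :
    pd a (stripMap d) ζ = (exp (stripHeight d ζ * I) *
      (stripHeight d a * I * profile d ζ.im + a.im * profile' d ζ.im), stripHeight d a) := by
  have h : HasFDerivAt (stripMap d) _ ζ :=
    (hasFDerivAt_helix (hasDerivAt_profile hd _)).prodMk (hasFDerivAt_stripHeight d ζ)
  have h1 := pd_helix (d := d) (hasDerivAt_profile hd ζ.im) a
  have h2 := pd_stripHeight d a ζ
  refine Prod.ext ?_ ?_
  · rw [← h1, fst_comp h.differentiableAt]; rfl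
  · rw [← h2, snd_comp h.differentiableAt]; rfl

/-- The strip parametrization induces the hyperbolic metric `|dζ|² / cos² (Im ζ)`. -/
lemma induced_stripMap {d : ℝ} (hd : 0 < d) {ζ : ℂ} (h : 0 < Real.cos ζ.im) (a c : ℂ) :
    induced (stripMap d) ζ a c = (a.re * c.re + a.im * c.im) / Real.cos ζ.im ^ 2 := by
  have hD := (cos_add_screwB_pos hd ζ.im).ne'
  have hb0 : screwB d ≠ 0 := by linarith [one_lt_screwB hd]
  have hs := Real.sin_sq ζ.im
  have hb := screwB_sq d
  rw [induced, metric, pd_stripMap hd, pd_stripMap hd]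
  simp only [inner_exp_mul]
  rw [stripMap, sigma_helix hd, Complex.inner]
  simp [profile, profile', stripHeight]
  generalize Real.cos ζ.im = x at *
  generalize Real.sin ζ.im = y at *
  generalize screwB d = b at *
  field_simp
  grind

lemma profile_harmonic {d : ℝ} (hd : 0 < d) {y r : ℝ}
    (hr : r * Real.cos y = Real.cos y + screwB d) :
    -profile d y + 2 * (d / screwB d : ℂ) * I * profile' d y + profile'' d y +
      r * starRingEnd ℂ (profile d y) *
        (-((screwB d : ℂ)⁻¹ ^ 2) * profile d y ^ 2 +
          ((d / screwB d : ℂ) * I * profile d y + profile' d y) ^ 2) = 0 := by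
  have hD := (cos_add_screwB_pos hd y).ne'
  have hb0 : screwB d ≠ 0 := by linarith [one_lt_screwB hd]
  have hs := Real.sin_sq y
  have hb := screwB_sq d
  apply Complex.ext
  all_goals
    simp [profile, profile', profile'', pow_two]
    generalize Real.cos y = c at *
    generalize Real.sin y = y at *
    generalize screwB d = b at *
    field_simp
    grind

/-- The strip parametrization is harmonic. -/
lemma covDeriv_stripMap {d : ℝ} (hd : 0 < d) {ζ : ℂ} (h : 0 < Real.cos ζ.im) :
    covDeriv (stripMap d) 1 1 ζ + covDeriv (stripMap d) I I ζ = 0 := by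
  have hb0 : (screwB d : ℂ) ≠ 0 := ofReal_ne_zero.2 (by linarith [one_lt_screwB hd])
  have e1 : (fun p => (stripMap d p).1) = helix d (profile d) := rfl
  have e2 : (fun p => (stripMap d p).2) = stripHeight d := rfl
  have hf : ∀ a, pd a (pd a (stripHeight d)) ζ = 0 := by
    intro a
    have : pd a (stripHeight d) = fun _ => stripHeight d a := funext (pd_stripHeight d a)
    rw [this]
    simp [pd]
  have h1 := hasDerivAt_profile hd
  have h2 := hasDerivAt_profile' hd
  have h11 : pd 1 (pd 1 (helix d (profile d))) ζ =
      exp (stripHeight d ζ * I) * (-((screwB d : ℂ)⁻¹ ^ 2) * profile d ζ.im) := by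
    rw [pd_one_helix h1, pd_one_helix fun y => (h1 y).const_mul _, helix]
    linear_combination exp (stripHeight d ζ * I) * (screwB d : ℂ)⁻¹ ^ 2 * profile d ζ.im * I_sq
  have h22 : pd I (pd I (helix d (profile d))) ζ =
      exp (stripHeight d ζ * I) * (-((d / screwB d : ℂ) ^ 2) * profile d ζ.im +
        2 * (d / screwB d : ℂ) * I * profile' d ζ.im + profile'' d ζ.im) := by
    have h3 : ∀ y, HasDerivAt (fun y => (d / screwB d : ℂ) * I * profile d y + profile' d y)
        ((d / screwB d : ℂ) * I * profile' d y + profile'' d y) y :=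
      fun y => ((h1 y).const_mul _).add (h2 y)
    rw [pd_I_helix h1, pd_I_helix h3, helix]
    linear_combination exp (stripHeight d ζ * I) * (d / screwB d : ℂ) ^ 2 * profile d ζ.im * I_sq
  have hbC : (screwB d : ℂ)⁻¹ ^ 2 + (d / screwB d : ℂ) ^ 2 = 1 := by
    have : (screwB d : ℂ) ^ 2 = 1 + d ^ 2 := by exact_mod_cast screwB_sq d
    field_simp
    exact this.symm
  have hexp : starRingEnd ℂ (exp (stripHeight d ζ * I)) * exp (stripHeight d ζ * I) = 1 := by
    rw [← Complex.exp_conj, ← Complex.exp_add]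
    simp
  have hΓ : 2 * dW (fun z => (Real.log (sigma z) : ℂ)) (helix d (profile d) ζ) =
      (((Real.cos ζ.im + screwB d) / Real.cos ζ.im : ℝ) : ℂ) *
        (starRingEnd ℂ (exp (stripHeight d ζ * I)) * starRingEnd ℂ (profile d ζ.im)) := by
    have hc : (Real.cos ζ.im : ℂ) ≠ 0 := ofReal_ne_zero.2 h.ne'
    have hD : (Real.cos ζ.im + screwB d : ℂ) ≠ 0 := by
      exact_mod_cast (cos_add_screwB_pos hd ζ.im).ne'
    rw [dW_log_sigma (helix_mem_disk hd h), one_sub_norm_helix_sq hd, helix, map_mul]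
    push_cast
    field_simp
  have hmain := profile_harmonic hd (div_mul_cancel₀ _ h.ne')
  refine Prod.ext ?_ ?_
  · simp only [covDeriv, Prod.fst_add, e1]
    rw [h11, h22, show (stripMap d ζ).1 = helix d (profile d) ζ from rfl, hΓ]
    simp only [pd_one_helix h1, pd_I_helix h1]
    simp only [helix, Prod.fst_zero]
    generalize exp (stripHeight d ζ * I) = e at *
    generalize starRingEnd ℂ e = e' at *
    generalize profile d ζ.im = q at *
    generalize profile' d ζ.im = q' at *
    generalize starRingEnd ℂ q = q0 at *
    generalize (((Real.cos ζ.im + screwB d) / Real.cos ζ.im : ℝ) : ℂ) = r at *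
    generalize (screwB d : ℂ)⁻¹ = v at *
    generalize (d / screwB d : ℂ) = u at *
    linear_combination e * hmain - e * q * hbC +
      e * r * q0 * ((v * I * q) ^ 2 + (u * I * q + q') ^ 2) * hexp +
      e * r * q0 * v ^ 2 * q ^ 2 * I_sq
  · simp only [covDeriv, Prod.snd_add, e2, hf, Prod.snd_zero, add_zero]

/-! ### The screw motion surface -/

/-- The change of coordinates from geodesic polar to conformal coordinates: the strip coordinate of
the point `s + i τ`. -/
def stripCoord (d : ℝ) (w : ℂ) : ℂ := ⟨screwB d * w.im, Real.arctan (Real.sinh w.re)⟩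

lemma cos_arctan_sinh (s : ℝ) : Real.cos (Real.arctan (Real.sinh s)) = (Real.cosh s)⁻¹ := by
  rw [Real.cos_arctan, add_comm, ← Real.cosh_sq, Real.sqrt_sq (Real.cosh_pos s).le, one_div]

lemma sin_arctan_sinh (s : ℝ) :
    Real.sin (Real.arctan (Real.sinh s)) = Real.sinh s / Real.cosh s := by
  rw [Real.sin_arctan, add_comm, ← Real.cosh_sq, Real.sqrt_sq (Real.cosh_pos s).le]

lemma hasDerivAt_arctan_sinh (s : ℝ) :
    HasDerivAt (fun s => Real.arctan (Real.sinh s)) (Real.cosh s)⁻¹ s := by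
  refine (Real.hasDerivAt_sinh s).arctan.congr_deriv ?_
  have := (Real.cosh_pos s).ne'
  rw [add_comm 1, ← Real.cosh_sq]
  field_simp

lemma screwU_eq (d s : ℝ) : screwU d s = screwB d * Real.cosh s := rfl

lemma screwU_sq_sub_one (d s : ℝ) :
    screwU d s ^ 2 - 1 = d ^ 2 + (screwB d * Real.sinh s) ^ 2 := by
  rw [screwU_eq]
  linear_combination screwB d ^ 2 * Real.cosh_sq s + screwB_sq d

lemma screwU_sq_sub_one_pos {d : ℝ} (hd : 0 < d) (s : ℝ) : 0 < screwU d s ^ 2 - 1 := by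
  rw [screwU_sq_sub_one]
  positivity

lemma one_lt_screwU {d : ℝ} (hd : 0 < d) (s : ℝ) : 1 < screwU d s := by
  rw [screwU_eq]
  nlinarith [one_lt_screwB hd, Real.one_le_cosh s]

lemma continuous_screwU (d : ℝ) : Continuous (screwU d) :=
  continuous_const.mul Real.continuous_cosh

lemma screwLambda_eq {d : ℝ} (hd : 0 < d) (s : ℝ) :
    screwLambda d s = Real.arctan (screwB d * Real.sinh s / d) := by
  have hc : Continuous fun x => screwU d x / (screwU d x ^ 2 - 1) :=
    (continuous_screwU d).div (((continuous_screwU d).pow 2).sub continuous_const)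
      fun x => (screwU_sq_sub_one_pos hd x).ne'
  rw [screwLambda, ← intervalIntegral.integral_const_mul,
    intervalIntegral.integral_eq_sub_of_hasDerivAt
      (f := fun s => Real.arctan (screwB d * Real.sinh s / d)) (fun x _ => ?_)
      (Continuous.intervalIntegrable (hc.const_mul d) _ _)]
  · simp
  · refine (((Real.hasDerivAt_sinh x).const_mul (screwB d)).div_const d).arctan.congr_deriv ?_
    rw [screwU_sq_sub_one, screwU_eq]
    have : d ^ 2 + (screwB d * Real.sinh x) ^ 2 ≠ 0 := by positivity
    field_simp

lemma screwPhi_eq {d : ℝ} (hd : 0 < d) (s τ : ℝ) :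
    screwPhi d s τ = τ + d / screwB d * Real.arctan (Real.sinh s) -
      Real.arctan (screwB d * Real.sinh s / d) := by
  have hb : 0 < screwB d := by linarith [one_lt_screwB hd]
  have hU : ∀ x, screwU d x ≠ 0 := fun x => by linarith [one_lt_screwU hd x]
  have hc : Continuous fun x => 1 / (screwU d x * (screwU d x ^ 2 - 1)) :=
    continuous_const.div ((continuous_screwU d).mul
      (((continuous_screwU d).pow 2).sub continuous_const))
      fun x => mul_ne_zero (hU x) (screwU_sq_sub_one_pos hd x).ne'
  rw [screwPhi, ← intervalIntegral.integral_const_mul,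
    intervalIntegral.integral_eq_sub_of_hasDerivAt
      (f := fun s => Real.arctan (screwB d * Real.sinh s / d) -
        d / screwB d * Real.arctan (Real.sinh s)) (fun x _ => ?_)
      (Continuous.intervalIntegrable (hc.const_mul d) _ _)]
  · simp
    ring
  · refine ((((Real.hasDerivAt_sinh x).const_mul (screwB d)).div_const d).arctan.sub
      ((hasDerivAt_arctan_sinh x).const_mul (d / screwB d))).congr_deriv ?_
    have h1 := screwU_sq_sub_one d x
    have h2 := (screwU_sq_sub_one_pos hd x).ne'
    have h3 := hU x
    have h4 : 1 + (screwB d * Real.sinh x / d) ^ 2 = (screwU d x ^ 2 - 1) / d ^ 2 := by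
      rw [h1]
      field_simp
    have h5 := (Real.cosh_pos x).ne'
    rw [h4]
    generalize hq : screwU d x ^ 2 - 1 = q at *
    rw [screwU_eq] at *
    field_simp
    linear_combination hq

lemma tanh_screwRho_half {d : ℝ} (hd : 0 < d) (s : ℝ) :
    Real.tanh (screwRho d s / 2) = Real.sqrt (screwU d s ^ 2 - 1) / (1 + screwU d s) := by
  have hU := one_lt_screwU hd s
  have h1 := Real.sinh_two_mul (screwRho d s / 2)
  have h2 := Real.cosh_two_mul (screwRho d s / 2)
  have h3 := Real.cosh_sq (screwRho d s / 2)
  rw [mul_div_cancel₀ _ two_ne_zero, screwRho] at h1 h2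
  rw [Real.sinh_arcosh hU.le] at h1
  rw [Real.cosh_arcosh hU.le] at h2
  rw [h1, Real.tanh_eq_sinh_div_cosh, ← screwRho.eq_1]
  rw [← screwRho.eq_1] at h2
  have h4 := (Real.cosh_pos (screwRho d s / 2)).ne'
  rw [div_eq_div_iff h4 (by linarith), h2]
  linear_combination -Real.sinh (screwRho d s / 2) * h3

lemma screwSurface_eq {d : ℝ} (hd : 0 < d) (w : ℂ) :
    screwSurface d w = stripMap d (stripCoord d w) := by
  have hb : 0 < screwB d := by linarith [one_lt_screwB hd]
  have hh : screwLambda d w.re + screwPhi d w.re w.im = stripHeight d (stripCoord d w) := by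
    rw [screwLambda_eq hd, screwPhi_eq hd, stripHeight, stripCoord]
    field_simp
    ring
  have hφ : screwPhi d w.re w.im = stripHeight d (stripCoord d w) -
      Real.arctan (screwB d * Real.sinh w.re / d) := by
    rw [← hh, screwLambda_eq hd]
    ring
  set S := Real.sqrt (screwU d w.re ^ 2 - 1) with hS
  have hSpos : 0 < S := Real.sqrt_pos.2 (screwU_sq_sub_one_pos hd _)
  have hsq : Real.sqrt (1 + (screwB d * Real.sinh w.re / d) ^ 2) = S / d := by
    rw [hS, screwU_sq_sub_one]
    rw [show 1 + (screwB d * Real.sinh w.re / d) ^ 2 =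
      (d ^ 2 + (screwB d * Real.sinh w.re) ^ 2) / d ^ 2 by field_simp,
      Real.sqrt_div (by positivity), Real.sqrt_sq hd.le]
  have hc : Real.cos (Real.arctan (screwB d * Real.sinh w.re / d)) = d / S := by
    rw [Real.cos_arctan, hsq, one_div_div]
  have hs : Real.sin (Real.arctan (screwB d * Real.sinh w.re / d)) =
      screwB d * Real.sinh w.re / S := by
    rw [Real.sin_arctan, hsq]
    field_simp
  have hch := (Real.cosh_pos w.re).ne'
  have hU1 : 1 + screwB d * Real.cosh w.re ≠ 0 := by positivity
  have hprof : profile d (stripCoord d w).im = ⟨d / (1 + screwU d w.re),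
      -(screwB d * Real.sinh w.re) / (1 + screwU d w.re)⟩ := by
    have : (Real.cosh w.re)⁻¹ + screwB d ≠ 0 := by
      have := Real.cosh_pos w.re
      positivity
    rw [profile]
    simp only [stripCoord, cos_arctan_sinh, sin_arctan_sinh, screwU_eq]
    apply Complex.ext
    · simp only
      field_simp
    · simp only
      field_simp
  refine Prod.ext ?_ hh
  have hU2 : 1 + screwU d w.re ≠ 0 := hU1
  simp only [screwSurface, stripMap, helix, hprof, tanh_screwRho_half hd, hφ, Real.cos_sub,
    Real.sin_sub, hc, hs, ← hS]
  apply Complex.ext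
  · simp only [Complex.mul_re, Complex.exp_ofReal_mul_I_re, Complex.exp_ofReal_mul_I_im]
    field_simp
    ring
  · simp only [Complex.mul_im, Complex.exp_ofReal_mul_I_re, Complex.exp_ofReal_mul_I_im]
    field_simp
    ring

lemma screwSurface_eq_comp {d : ℝ} (hd : 0 < d) : screwSurface d = stripMap d ∘ stripCoord d :=
  funext (screwSurface_eq hd)

lemma cos_stripCoord_pos (d : ℝ) (w : ℂ) : 0 < Real.cos (stripCoord d w).im :=
  Real.cos_arctan_pos _

lemma contDiff_stripCoord (d : ℝ) : ContDiff ℝ ∞ (stripCoord d) := by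
  have h1 : ContDiff ℝ ∞ fun w : ℂ => screwB d * w.im := contDiff_const.mul imCLM.contDiff
  have h2 : ContDiff ℝ ∞ fun w : ℂ => Real.arctan (Real.sinh w.re) :=
    (Real.contDiff_sinh.comp reCLM.contDiff).arctan
  exact equivRealProdCLM.symm.contDiff.comp (h1.prodMk h2)

lemma pd_stripCoord (d : ℝ) (a w : ℂ) :
    pd a (stripCoord d) w = ⟨screwB d * a.im, (Real.cosh w.re)⁻¹ * a.re⟩ := by
  have h1 : HasFDerivAt (fun w : ℂ => screwB d * w.im) (screwB d • imCLM) w :=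
    imCLM.hasFDerivAt.const_mul _
  have h2 : HasFDerivAt (fun w : ℂ => Real.arctan (Real.sinh w.re))
      ((Real.cosh w.re)⁻¹ • reCLM) w :=
    HasDerivAt.comp_hasFDerivAt w (h₂ := fun s => Real.arctan (Real.sinh s))
      (hasDerivAt_arctan_sinh w.re) reCLM.hasFDerivAt
  have h3 : HasFDerivAt (stripCoord d) _ w :=
    (equivRealProdCLM.symm.toContinuousLinearMap.hasFDerivAt).comp w (h1.prodMk h2)
  rw [pd, h3.fderiv]
  rfl

lemma induced_screwSurface {d : ℝ} (hd : 0 < d) (w a c : ℂ) :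
    induced (screwSurface d) w a c = a.re * c.re + screwU d w.re ^ 2 * (a.im * c.im) := by
  have hch := (Real.cosh_pos w.re).ne'
  rw [screwSurface_eq_comp hd, induced_comp
    ((contDiff_stripMap hd).differentiable (by norm_num) _)
    ((contDiff_stripCoord d).differentiable (by norm_num) _),
    induced_stripMap hd (cos_stripCoord_pos d w), pd_stripCoord, pd_stripCoord, screwU_eq,
    stripCoord, cos_arctan_sinh]
  field_simp
  ring

lemma coeffE_screwSurface {d : ℝ} (hd : 0 < d) (w : ℂ) : coeffE (screwSurface d) w = 1 := by
  simp [coeffE, induced_screwSurface hd]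

lemma coeffF_screwSurface {d : ℝ} (hd : 0 < d) (w : ℂ) : coeffF (screwSurface d) w = 0 := by
  simp [coeffF, induced_screwSurface hd]

lemma coeffG_screwSurface {d : ℝ} (hd : 0 < d) (w : ℂ) :
    coeffG (screwSurface d) w = screwU d w.re ^ 2 := by
  simp [coeffG, induced_screwSurface hd]

lemma contDiff_screwSurface {d : ℝ} (hd : 0 < d) : ContDiff ℝ ∞ (screwSurface d) := by
  rw [screwSurface_eq_comp hd]
  exact (contDiff_stripMap hd).comp (contDiff_stripCoord d)

lemma isImmersionOn_screwSurface {d : ℝ} (hd : 0 < d) :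
    IsImmersionOn Set.univ (screwSurface d) := by
  refine ⟨(contDiff_screwSurface hd).contDiffOn, fun w _ => ?_, fun w _ => ?_⟩
  · rw [screwSurface_eq hd]
    exact helix_mem_disk hd (cos_stripCoord_pos d w)
  · refine injective_fderiv_of_induced_pos fun v hv => ?_
    have hU : 0 < screwU d w.re := by linarith [one_lt_screwU hd w.re]
    rw [induced_screwSurface hd]
    by_cases h : v.re = 0
    · have h' : v.im ≠ 0 := fun h' => hv (Complex.ext h h')
      rw [h]
      have := mul_self_pos.2 h'
      positivity
    · have := mul_self_pos.2 h
      have := mul_self_nonneg v.im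
      positivity

lemma isMinimalOn_screwSurface {d : ℝ} (hd : 0 < d) :
    IsMinimalOn Set.univ (screwSurface d) := by
  have hb : screwB d ≠ 0 := by linarith [one_lt_screwB hd]
  rw [screwSurface_eq_comp hd]
  refine isMinimalOn_comp ((contDiff_stripMap hd).of_le (by norm_cast))
    (fun w _ => ((contDiff_stripCoord d).of_le (by norm_cast)).contDiffAt)
    (fun w _ => covDeriv_stripMap hd (cos_stripCoord_pos d w)) (fun w _ v => ?_) (fun w _ => ?_)
    (fun w _ => ?_) (fun w _ => ?_) <;> have hch := (Real.cosh_pos w.re).ne'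
  · refine ⟨⟨Real.cosh w.re * v.im, (screwB d)⁻¹ * v.re⟩, ?_⟩
    have := pd_stripCoord d ⟨Real.cosh w.re * v.im, (screwB d)⁻¹ * v.re⟩ w
    rw [pd] at this
    rw [this]
    apply Complex.ext
    · exact mul_inv_cancel_left₀ hb _
    · exact inv_mul_cancel_left₀ hch _
  · rw [← screwSurface_eq_comp hd, coeffF_screwSurface hd]
  · rw [← screwSurface_eq_comp hd, coeffE_screwSurface hd, coeffG_screwSurface hd, pd_stripCoord,
      pd_stripCoord, screwU_eq]
    simp
    field_simp
  · rw [pd_stripCoord, pd_stripCoord]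
    simp

lemma isEmbedding_of_leftInverse {α β : Type*} [TopologicalSpace α] [TopologicalSpace β]
    {f : α → β} {g : β → α} (hf : Continuous f) (hgf : Function.LeftInverse g f)
    (hg : ∀ x, ContinuousAt g (f x)) : IsEmbedding f := by
  refine ⟨isInducing_iff_nhds.2 fun x => le_antisymm (hf.tendsto x).le_comap ?_, hgf.injective⟩
  intro s hs
  rw [← hgf x] at hs
  refine ⟨_, hg x hs, fun y hy => ?_⟩
  simpa [hgf y] using hy

lemma isEmbedding_screwSurface {d : ℝ} (hd : 0 < d) : IsEmbedding (screwSurface d) := by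
  have hb : screwB d ≠ 0 := by linarith [one_lt_screwB hd]
  let v : ℂ × ℝ → ℂ := fun p => exp (-(p.2 * I)) * p.1
  let r : ℂ × ℝ → ℝ := fun p => -(d * (v p).im) / (screwB d * (v p).re)
  let g : ℂ × ℝ → ℂ := fun p =>
    Real.arsinh (r p) + (p.2 - d / screwB d * Real.arctan (r p) : ℝ) * I
  have hv : ∀ w, v (screwSurface d w) = profile d (stripCoord d w).im := by
    intro w
    rw [screwSurface_eq hd]
    simp only [v, stripMap, helix]
    rw [← mul_assoc, ← Complex.exp_add]
    simp
  have hre : ∀ w, (v (screwSurface d w)).re ≠ 0 := by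
    intro w
    rw [hv]
    exact (div_pos (mul_pos hd (cos_stripCoord_pos d w)) (cos_add_screwB_pos hd _)).ne'
  have hr : ∀ w, r (screwSurface d w) = Real.sinh w.re := by
    intro w
    have h1 := (cos_add_screwB_pos hd (stripCoord d w).im).ne'
    have hch := (Real.cosh_pos w.re).ne'
    simp only [r, hv, profile]
    generalize hq : Real.cos (stripCoord d w).im + screwB d = q at *
    simp only [stripCoord, cos_arctan_sinh, sin_arctan_sinh]
    field_simp
  refine isEmbedding_of_leftInverse (g := g) (contDiff_screwSurface hd).continuous (fun w => ?_)
    fun w => ?_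
  · have h2 : (screwSurface d w).2 = stripHeight d (stripCoord d w) := by
      rw [screwSurface_eq hd]
      rfl
    simp only [g, hr, h2, Real.arsinh_sinh, stripHeight, stripCoord]
    apply Complex.ext
    · simp only [add_re, ofReal_re, mul_re, I_re, I_im, ofReal_im]
      ring
    · simp only [add_im, ofReal_re, mul_im, I_re, I_im, ofReal_im]
      field_simp
      ring
  · have hvc : Continuous v := by fun_prop
    have hrc : ContinuousAt r (screwSurface d w) := by
      refine ContinuousAt.div (by fun_prop) (by fun_prop) (mul_ne_zero hb (hre w))
    have h1 : ContinuousAt (fun p => Real.arsinh (r p)) (screwSurface d w) :=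
      Real.continuous_arsinh.continuousAt.comp hrc
    have h2 : ContinuousAt (fun p => Real.arctan (r p)) (screwSurface d w) :=
      Real.continuous_arctan.continuousAt.comp hrc
    simp only [g]
    fun_prop

lemma screwMotion_screwSurface {d : ℝ} (hd : 0 < d) (α : ℝ) (w : ℂ) :
    screwMotion 1 α (screwSurface d w) = screwSurface d (w + α * I) := by
  have hb : screwB d ≠ 0 := by linarith [one_lt_screwB hd]
  have hc : stripHeight d (stripCoord d (w + α * I)) = stripHeight d (stripCoord d w) + α := by
    simp [stripHeight, stripCoord]
    field_simp
    ring
  have hi : (stripCoord d (w + α * I)).im = (stripCoord d w).im := by simp [stripCoord]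
  rw [screwSurface_eq hd, screwSurface_eq hd]
  simp only [screwMotion, stripMap, helix, hc, hi, one_mul, ← mul_assoc, ← Complex.exp_add]
  push_cast
  rw [add_mul, add_comm (α * I : ℂ)]

lemma screwMotion_image_range {d : ℝ} (hd : 0 < d) (α : ℝ) :
    screwMotion 1 α '' Set.range (screwSurface d) = Set.range (screwSurface d) := by
  ext p
  constructor
  · rintro ⟨_, ⟨w, rfl⟩, rfl⟩
    exact ⟨_, (screwMotion_screwSurface hd α w).symm⟩
  · rintro ⟨w, rfl⟩
    exact ⟨_, ⟨w - α * I, rfl⟩, by rw [screwMotion_screwSurface hd, sub_add_cancel]⟩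

lemma pd_comp_re {g : ℝ → ℝ} {g' : ℝ} {w : ℂ} (h : HasDerivAt g g' w.re) (a : ℂ) :
    pd a (fun w => g w.re) w = a.re * g' := by
  have := HasDerivAt.comp_hasFDerivAt w (h₂ := g) h reCLM.hasFDerivAt
  have h2 : fderiv ℝ (fun w : ℂ => g w.re) w = g' • reCLM := this.fderiv
  simp [pd, h2, mul_comm]

lemma gaussCurvature_screwSurface {d : ℝ} (hd : 0 < d) (w : ℂ) :
    gaussCurvature (screwSurface d) w = -1 := by
  have hb : screwB d ≠ 0 := by linarith [one_lt_screwB hd]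
  have hch := (Real.cosh_pos w.re).ne'
  have hE : coeffE (screwSurface d) = fun _ => 1 := funext (coeffE_screwSurface hd)
  have hF : coeffF (screwSurface d) = fun _ => 0 := funext (coeffF_screwSurface hd)
  have hG : coeffG (screwSurface d) = fun w => (fun s => screwB d ^ 2 * Real.cosh s ^ 2) w.re := by
    funext w
    rw [coeffG_screwSurface hd, screwU_eq, mul_pow]
  have hG1 : ∀ a, pd a (fun w : ℂ => (fun s => screwB d ^ 2 * Real.cosh s ^ 2) w.re) =
      fun w => (fun s => a.re * (screwB d ^ 2 * (2 * Real.cosh s * Real.sinh s))) w.re := by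
    intro a
    funext w
    have h : HasDerivAt (fun s => screwB d ^ 2 * Real.cosh s ^ 2)
        (screwB d ^ 2 * (2 * Real.cosh w.re * Real.sinh w.re)) w.re := by
      simpa using ((Real.hasDerivAt_cosh w.re).pow 2).const_mul (screwB d ^ 2)
    exact pd_comp_re h a
  have hG2 : pd 1 (fun w : ℂ =>
      (fun s => (1 : ℂ).re * (screwB d ^ 2 * (2 * Real.cosh s * Real.sinh s))) w.re) w =
      screwB d ^ 2 * (2 * (Real.sinh w.re * Real.sinh w.re + Real.cosh w.re * Real.cosh w.re)) := by
    have h : HasDerivAt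
        (fun s => (1 : ℂ).re * (screwB d ^ 2 * (2 * Real.cosh s * Real.sinh s))) _ w.re :=
      ((((Real.hasDerivAt_cosh w.re).const_mul 2).mul
        (Real.hasDerivAt_sinh w.re)).const_mul (screwB d ^ 2)).const_mul (1 : ℂ).re
    rw [pd_comp_re h, Complex.one_re]
    ring
  have hc : ∀ (a : ℂ) (k : ℝ), pd a (fun _ => k) = fun _ : ℂ => (0 : ℝ) := fun a k => by
    funext w
    simp [pd]
  unfold gaussCurvature
  simp only [hE, hF, hG, hc, hG1, hG2, Matrix.det_fin_three]
  simp
  field_simp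
  ring

/-! ### The conformal map from the disk to the strip -/

/-- The conformal map `w ↦ log ((1 + w) / (1 - w))` from the disk onto the strip
`|Im ζ| < π / 2`. -/
def diskToStrip (w : ℂ) : ℂ := log ((1 + w) / (1 - w))

lemma one_sub_ne_zero_of_mem_disk {w : ℂ} (hw : w ∈ disk) : 1 - w ≠ 0 := by
  intro h
  rw [← sub_eq_zero.1 h, mem_disk_iff] at hw
  simp at hw

lemma one_add_ne_zero_of_mem_disk {w : ℂ} (hw : w ∈ disk) : 1 + w ≠ 0 := by
  intro h
  rw [(neg_eq_of_add_eq_zero_right h).symm, mem_disk_iff] at hw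
  simp at hw

lemma cayley_re (w : ℂ) : ((1 + w) / (1 - w)).re = (1 - ‖w‖ ^ 2) / ‖1 - w‖ ^ 2 := by
  rw [Complex.div_re, Complex.sq_norm, Complex.sq_norm, ← add_div, normSq_apply w]
  congr 1
  simp
  ring

lemma cayley_re_pos {w : ℂ} (hw : w ∈ disk) : 0 < ((1 + w) / (1 - w)).re := by
  rw [cayley_re]
  have := norm_pos_iff.2 (one_sub_ne_zero_of_mem_disk hw)
  exact div_pos (one_sub_norm_sq_pos hw) (by positivity)

lemma abs_diskToStrip_im_lt {w : ℂ} (hw : w ∈ disk) : |(diskToStrip w).im| < Real.pi / 2 := by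
  rw [diskToStrip, log_im]
  exact abs_arg_lt_pi_div_two_iff.2 (Or.inl (cayley_re_pos hw))

lemma cos_diskToStrip_pos {w : ℂ} (hw : w ∈ disk) : 0 < Real.cos (diskToStrip w).im :=
  Real.cos_pos_of_mem_Ioo (abs_lt.1 (abs_diskToStrip_im_lt hw))

lemma hasDerivAt_diskToStrip {w : ℂ} (hw : w ∈ disk) :
    HasDerivAt diskToStrip (2 / ((1 - w) * (1 + w))) w := by
  have h1 := one_sub_ne_zero_of_mem_disk hw
  have h2 := one_add_ne_zero_of_mem_disk hw
  have h3 : HasDerivAt (fun w : ℂ => (1 + w) / (1 - w)) _ w :=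
    ((hasDerivAt_id w).const_add 1).div ((hasDerivAt_id w).const_sub 1) h1
  refine (h3.clog (Or.inl (cayley_re_pos hw))).congr_deriv ?_
  simp only [id]
  field_simp
  ring

lemma pd_diskToStrip {w : ℂ} (hw : w ∈ disk) (a : ℂ) :
    pd a diskToStrip w = 2 / ((1 - w) * (1 + w)) * a := by
  have h := ((hasDerivAt_diskToStrip hw).hasFDerivAt.restrictScalars ℝ).fderiv
  rw [pd, h]
  simp [mul_comm]

lemma contDiffAt_diskToStrip {w : ℂ} (hw : w ∈ disk) {n : WithTop ℕ∞} :
    ContDiffAt ℝ n diskToStrip w := by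
  have h1 : ContDiffAt ℂ n (fun w : ℂ => (1 + w) / (1 - w)) w :=
    (contDiffAt_const.add contDiffAt_id).div (contDiffAt_const.sub contDiffAt_id)
      (one_sub_ne_zero_of_mem_disk hw)
  exact ((contDiffAt_log (Or.inl (cayley_re_pos hw))).comp w h1).restrict_scalars ℝ

lemma diskToStrip_injOn : Set.InjOn diskToStrip disk := by
  intro w hw w' hw' h
  have h1 := one_sub_ne_zero_of_mem_disk hw
  have h1' := one_sub_ne_zero_of_mem_disk hw'
  have h2 := congrArg exp h
  rw [diskToStrip, diskToStrip,
    exp_log (div_ne_zero (one_add_ne_zero_of_mem_disk hw) h1),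
    exp_log (div_ne_zero (one_add_ne_zero_of_mem_disk hw') h1'), div_eq_div_iff h1 h1'] at h2
  linear_combination h2 / 2

lemma exists_diskToStrip_eq {ζ : ℂ} (h : |ζ.im| < Real.pi / 2) : ∃ w ∈ disk, diskToStrip w = ζ := by
  have hre : 0 < (exp ζ).re := by
    rw [exp_re]
    exact mul_pos (Real.exp_pos _) (Real.cos_pos_of_mem_Ioo (abs_lt.1 h))
  have hne : exp ζ + 1 ≠ 0 := fun h0 => by
    have := congrArg re h0
    simp only [add_re, one_re, zero_re] at this
    linarith
  refine ⟨(exp ζ - 1) / (exp ζ + 1), ?_, ?_⟩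
  · rw [mem_disk_iff, norm_div, div_lt_one (norm_pos_iff.2 hne)]
    refine lt_of_pow_lt_pow_left₀ 2 (norm_nonneg _) ?_
    rw [Complex.sq_norm, Complex.sq_norm, normSq_apply, normSq_apply]
    simp only [add_re, sub_re, one_re, add_im, sub_im, one_im]
    nlinarith
  · have h1 : (1 + (exp ζ - 1) / (exp ζ + 1)) / (1 - (exp ζ - 1) / (exp ζ + 1)) = exp ζ := by
      rw [show 1 + (exp ζ - 1) / (exp ζ + 1) = 2 * exp ζ / (exp ζ + 1) by field_simp; ring,
        show 1 - (exp ζ - 1) / (exp ζ + 1) = 2 / (exp ζ + 1) by field_simp; ring]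
      field_simp
    have := abs_lt.1 h
    rw [diskToStrip, h1, log_exp] <;> linarith [Real.pi_pos]

lemma exists_stripCoord_eq {d : ℝ} (hd : 0 < d) {ζ : ℂ} (h : |ζ.im| < Real.pi / 2) :
    ∃ u, stripCoord d u = ζ := by
  have hb : screwB d ≠ 0 := by linarith [one_lt_screwB hd]
  have := abs_lt.1 h
  refine ⟨⟨Real.arsinh (Real.tan ζ.im), ζ.re / screwB d⟩, ?_⟩
  apply Complex.ext
  · simp only [stripCoord]
    field_simp
  · simp only [stripCoord]
    rw [Real.sinh_arsinh, Real.arctan_tan this.1 this.2]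

lemma norm_deriv_div_cos {w : ℂ} (hw : w ∈ disk) :
    ‖2 / ((1 - w) * (1 + w))‖ ^ 2 / Real.cos (diskToStrip w).im ^ 2 = sigma w ^ 2 := by
  have h1 := norm_ne_zero_iff.2 (one_sub_ne_zero_of_mem_disk hw)
  have h2 := norm_ne_zero_iff.2 (one_add_ne_zero_of_mem_disk hw)
  have h3 := (one_sub_norm_sq_pos hw).ne'
  rw [diskToStrip, log_im, cos_arg (div_ne_zero (one_add_ne_zero_of_mem_disk hw)
    (one_sub_ne_zero_of_mem_disk hw)), cayley_re, sigma, ← div_pow, norm_div, norm_div, norm_mul,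
    Complex.norm_two]
  congr 1
  field_simp

/-! ### The conformal parametrization of the screw motion surface by the disk -/

/-- The conformal parametrization of the screw motion surface by the disk. -/
def screwDisk (d : ℝ) : ℂ → ℂ × ℝ := stripMap d ∘ diskToStrip

lemma induced_screwDisk {d : ℝ} (hd : 0 < d) {w : ℂ} (hw : w ∈ disk) (a c : ℂ) :
    induced (screwDisk d) w a c = sigma w ^ 2 * (a.re * c.re + a.im * c.im) := by
  rw [screwDisk, induced_comp ((contDiff_stripMap hd).differentiable (by norm_num) _)
    ((contDiffAt_diskToStrip (n := 1) hw).differentiableAt (by norm_num)),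
    induced_stripMap hd (cos_diskToStrip_pos hw), pd_diskToStrip hw, pd_diskToStrip hw,
    ← norm_deriv_div_cos hw]
  generalize 2 / ((1 - w) * (1 + w)) = α
  rw [Complex.sq_norm, normSq_apply]
  simp only [mul_re, mul_im]
  ring

lemma contDiffOn_screwDisk {d : ℝ} (hd : 0 < d) : ContDiffOn ℝ ∞ (screwDisk d) disk := fun w hw =>
  ((contDiff_stripMap hd).contDiffAt.comp w (contDiffAt_diskToStrip hw)).contDiffWithinAt

lemma screwDisk_mem_disk {d : ℝ} (hd : 0 < d) {w : ℂ} (hw : w ∈ disk) : (screwDisk d w).1 ∈ disk :=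
  helix_mem_disk hd (cos_diskToStrip_pos hw)

lemma screwDisk_eq {d : ℝ} {w u : ℂ} (hd : 0 < d) (h : stripCoord d u = diskToStrip w) :
    screwDisk d w = screwSurface d u := by
  rw [screwSurface_eq hd, h, screwDisk, Function.comp_apply]

lemma screwDisk_injOn {d : ℝ} (hd : 0 < d) : Set.InjOn (screwDisk d) disk := by
  intro w hw w' hw' h
  obtain ⟨u, hu⟩ := exists_stripCoord_eq hd (abs_diskToStrip_im_lt hw)
  obtain ⟨u', hu'⟩ := exists_stripCoord_eq hd (abs_diskToStrip_im_lt hw')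
  rw [screwDisk_eq hd hu, screwDisk_eq hd hu'] at h
  have := (isEmbedding_screwSurface hd).injective h
  exact diskToStrip_injOn hw hw' (by rw [← hu, ← hu', this])

lemma screwDisk_image {d : ℝ} (hd : 0 < d) :
    screwDisk d '' disk = Set.range (screwSurface d) := by
  ext p
  constructor
  · rintro ⟨w, hw, rfl⟩
    obtain ⟨u, hu⟩ := exists_stripCoord_eq hd (abs_diskToStrip_im_lt hw)
    exact ⟨u, (screwDisk_eq hd hu).symm⟩
  · rintro ⟨u, rfl⟩
    obtain ⟨w, hw, h⟩ := exists_diskToStrip_eq (ζ := stripCoord d u)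
      (abs_lt.2 (Real.arctan_mem_Ioo (Real.sinh u.re)))
    exact ⟨w, hw, screwDisk_eq hd h.symm⟩

lemma isMinimalOn_screwDisk {d : ℝ} (hd : 0 < d) : IsMinimalOn disk (screwDisk d) := by
  have hE : ∀ w ∈ disk, coeffE (stripMap d ∘ diskToStrip) w = sigma w ^ 2 := fun w hw =>
    (induced_screwDisk hd hw 1 1).trans (by simp)
  have hG : ∀ w ∈ disk, coeffG (stripMap d ∘ diskToStrip) w = sigma w ^ 2 := fun w hw =>
    (induced_screwDisk hd hw I I).trans (by simp)
  refine isMinimalOn_comp ((contDiff_stripMap hd).of_le (by norm_cast))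
    (fun w hw => contDiffAt_diskToStrip hw)
    (fun w hw => covDeriv_stripMap hd (cos_diskToStrip_pos hw)) (fun w hw v => ?_)
    (fun w hw => (induced_screwDisk hd hw 1 I).trans (by simp)) (fun w hw => ?_) (fun w hw => ?_)
  · have h1 := one_sub_ne_zero_of_mem_disk hw
    have h2 := one_add_ne_zero_of_mem_disk hw
    refine ⟨(1 - w) * (1 + w) / 2 * v, (pd_diskToStrip hw _).trans ?_⟩
    field_simp
  · rw [hE w hw, hG w hw, pd_diskToStrip hw, pd_diskToStrip hw]
    simp only [mul_re, mul_im, I_re, I_im, one_re, one_im]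
    ring
  · rw [hE w hw, hG w hw, pd_diskToStrip hw, pd_diskToStrip hw]
    simp only [mul_re, mul_im, I_re, I_im, one_re, one_im]
    ring

lemma exists_pd_screwDisk_snd_ne_zero {d : ℝ} (hd : 0 < d) {w : ℂ} (hw : w ∈ disk) :
    ∃ a, (pd a (screwDisk d) w).2 ≠ 0 := by
  have h1 := one_sub_ne_zero_of_mem_disk hw
  have h2 := one_add_ne_zero_of_mem_disk hw
  have hb : screwB d ≠ 0 := by linarith [one_lt_screwB hd]
  refine ⟨(1 - w) * (1 + w) / 2, ?_⟩
  rw [screwDisk, pd_comp ((contDiff_stripMap hd).differentiable (by norm_num) _)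
    ((contDiffAt_diskToStrip (n := 1) hw).differentiableAt (by norm_num)), pd_diskToStrip hw,
    pd_stripMap hd, show 2 / ((1 - w) * (1 + w)) * ((1 - w) * (1 + w) / 2) = 1 by field_simp]
  simpa [stripHeight] using hb

/-! ### Surfaces that induce the hyperbolic metric on the disk -/

/-- `X` induces the hyperbolic metric `σ² |dw|²` on the disk. -/
def IsHyperbolicOnDisk (X : ℂ → ℂ × ℝ) : Prop :=
  ∀ w ∈ disk, ∀ a c : ℂ, induced X w a c = sigma w ^ 2 * (a.re * c.re + a.im * c.im)

namespace IsHyperbolicOnDisk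

variable {X : ℂ → ℂ × ℝ}

lemma coeffE_eq (h : IsHyperbolicOnDisk X) {w : ℂ} (hw : w ∈ disk) :
    coeffE X w = sigma w ^ 2 := by simp [coeffE, h w hw]

lemma coeffF_eq (h : IsHyperbolicOnDisk X) {w : ℂ} (hw : w ∈ disk) :
    coeffF X w = 0 := by simp [coeffF, h w hw]

lemma coeffG_eq (h : IsHyperbolicOnDisk X) {w : ℂ} (hw : w ∈ disk) :
    coeffG X w = sigma w ^ 2 := by simp [coeffG, h w hw]

lemma isConformalOn (h : IsHyperbolicOnDisk X) : IsConformalOn disk X := fun _ hw =>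
  ⟨(h.coeffE_eq hw).trans (h.coeffG_eq hw).symm, h.coeffF_eq hw⟩

lemma areIsometricOn (h : IsHyperbolicOnDisk X) {Y : ℂ → ℂ × ℝ} (h' : IsHyperbolicOnDisk Y) :
    AreIsometricOn disk X Y := fun _ hw =>
  ⟨(h.coeffE_eq hw).trans (h'.coeffE_eq hw).symm, (h.coeffF_eq hw).trans (h'.coeffF_eq hw).symm,
    (h.coeffG_eq hw).trans (h'.coeffG_eq hw).symm⟩

lemma injective_fderiv (h : IsHyperbolicOnDisk X) {w : ℂ} (hw : w ∈ disk) :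
    Function.Injective (fderiv ℝ X w) := by
  refine injective_fderiv_of_induced_pos fun v hv => ?_
  rw [h w hw, ← normSq_apply]
  exact mul_pos (pow_pos (sigma_pos hw) 2) (normSq_pos.2 hv)

end IsHyperbolicOnDisk

lemma hasFDerivAt_one_sub_norm_sq (p : ℂ) :
    HasFDerivAt (fun z : ℂ => 1 - ‖z‖ ^ 2) (-((2 : ℝ) • innerSL ℝ p)) p := by
  refine ((hasStrictFDerivAt_norm_sq p).hasFDerivAt.const_sub 1).congr_fderiv ?_
  ext a
  simp
  ring

lemma pd_sigma_sq {p : ℂ} (hp : p ∈ disk) (a : ℂ) :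
    pd a (fun z => sigma z ^ 2) p = 16 * (p.re * a.re + p.im * a.im) / (1 - ‖p‖ ^ 2) ^ 3 := by
  have hN := (one_sub_norm_sq_pos hp).ne'
  have h1 : HasDerivAt (fun n : ℝ => (2 / n) ^ 2) (-8 / (1 - ‖p‖ ^ 2) ^ 3) (1 - ‖p‖ ^ 2) := by
    refine (((hasDerivAt_const _ (2 : ℝ)).div (hasDerivAt_id _) hN).pow 2).congr_deriv ?_
    simp
    field_simp
    norm_num
  have h2 : fderiv ℝ (fun z => sigma z ^ 2) p = _ :=

    (HasDerivAt.comp_hasFDerivAt (h₂ := fun n : ℝ => (2 / n) ^ 2) p h1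
      (hasFDerivAt_one_sub_norm_sq p)).fderiv
  rw [pd, h2]
  simp [Complex.inner]
  field_simp
  ring

lemma pd_linear_div {p : ℂ} (hp : p ∈ disk) (l : ℂ →L[ℝ] ℝ) (a : ℂ) :
    pd a (fun z => 16 * l z / (1 - ‖z‖ ^ 2) ^ 3) p =
      16 * l a / (1 - ‖p‖ ^ 2) ^ 3 +
        96 * l p * (p.re * a.re + p.im * a.im) / (1 - ‖p‖ ^ 2) ^ 4 := by
  have hN := (one_sub_norm_sq_pos hp).ne'
  have h1 : HasDerivAt (fun n : ℝ => (n ^ 3)⁻¹) (-3 / (1 - ‖p‖ ^ 2) ^ 4) (1 - ‖p‖ ^ 2) := by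
    refine (HasDerivAt.fun_inv (c := fun n : ℝ => n ^ 3) (hasDerivAt_pow 3 _)
      (pow_ne_zero 3 hN)).congr_deriv ?_
    field_simp
    norm_num
    ring
  have h2 : fderiv ℝ (fun z => 16 * l z * ((1 - ‖z‖ ^ 2) ^ 3)⁻¹) p = _ :=
    ((l.hasFDerivAt.const_mul 16).mul (HasDerivAt.comp_hasFDerivAt (h₂ := fun n : ℝ => (n ^ 3)⁻¹) p
      h1 (hasFDerivAt_one_sub_norm_sq p))).fderiv
  simp only [div_eq_mul_inv (16 * l _)]
  rw [pd, h2]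
  simp [Complex.inner]
  field_simp
  ring

lemma pd_congr {V : Type*} [NormedAddCommGroup V] [NormedSpace ℝ V] {F G : ℂ → V} {w : ℂ}
    (h : F =ᶠ[𝓝 w] G) (a : ℂ) : pd a F =ᶠ[𝓝 w] pd a G := by
  filter_upwards [Filter.EventuallyEq.fderiv (𝕜 := ℝ) h] with p hp
  simp only [pd, hp]

lemma IsHyperbolicOnDisk.gaussCurvature_eq {X : ℂ → ℂ × ℝ} (h : IsHyperbolicOnDisk X) {w : ℂ}
    (hw : w ∈ disk) : gaussCurvature X w = -1 := by
  have hnhds := isOpen_disk.mem_nhds hw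
  have hE : coeffE X =ᶠ[𝓝 w] fun z => sigma z ^ 2 := by
    filter_upwards [hnhds] with p hp using h.coeffE_eq hp
  have hF : coeffF X =ᶠ[𝓝 w] fun z => 0 := by
    filter_upwards [hnhds] with p hp using h.coeffF_eq hp
  have hG : coeffG X =ᶠ[𝓝 w] fun z => sigma z ^ 2 := by
    filter_upwards [hnhds] with p hp using h.coeffG_eq hp
  have hc : ∀ a : ℂ, pd a (fun _ : ℂ => (0 : ℝ)) = fun _ => 0 := fun a => by
    funext p
    simp [pd]
  have hF1 : ∀ a, pd a (coeffF X) w = 0 := fun a => by rw [(pd_congr hF a).self_of_nhds, hc]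
  have hF2 : pd 1 (pd I (coeffF X)) w = 0 := by
    rw [(pd_congr (pd_congr hF I) 1).self_of_nhds, hc, hc]
  have hs1 : pd 1 (fun z => sigma z ^ 2) =ᶠ[𝓝 w]
      fun z => 16 * reCLM z / (1 - ‖z‖ ^ 2) ^ 3 := by
    filter_upwards [hnhds] with p hp
    rw [pd_sigma_sq hp]
    simp
  have hsI : pd I (fun z => sigma z ^ 2) =ᶠ[𝓝 w]
      fun z => 16 * imCLM z / (1 - ‖z‖ ^ 2) ^ 3 := by
    filter_upwards [hnhds] with p hp
    rw [pd_sigma_sq hp]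
    simp
  have hG1 : pd 1 (pd 1 (coeffG X)) w = _ :=
    (pd_congr ((pd_congr hG 1).trans hs1) 1).self_of_nhds.trans (pd_linear_div hw _ _)
  have hE2 : pd I (pd I (coeffE X)) w = _ :=
    (pd_congr ((pd_congr hE I).trans hsI) I).self_of_nhds.trans (pd_linear_div hw _ _)
  have e1 := ((pd_congr hE 1).trans hs1).self_of_nhds
  have e2 := ((pd_congr hE I).trans hsI).self_of_nhds
  have g1 := ((pd_congr hG 1).trans hs1).self_of_nhds
  have g2 := ((pd_congr hG I).trans hsI).self_of_nhds
  have hN := (one_sub_norm_sq_pos hw).ne'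
  have hN' : ‖w‖ ^ 2 = w.re * w.re + w.im * w.im := by rw [Complex.sq_norm, normSq_apply]
  unfold gaussCurvature
  simp only [hF1, hF2, hG1, hE2, e1, e2, g1, g2, h.coeffE_eq hw, h.coeffF_eq hw, h.coeffG_eq hw,
    Matrix.det_fin_three, sigma]
  simp
  field_simp
  rw [hN']
  ring

/-! ### Completeness -/

namespace IsHyperbolicOnDisk

variable {X : ℂ → ℂ × ℝ}

lemma inducedLength_eq (h : IsHyperbolicOnDisk X) {γ : ℝ → ℂ}
    (hγ : ∀ t ∈ Set.Icc (0 : ℝ) 1, γ t ∈ disk) :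
    inducedLength X γ =
      ∫⁻ t in Set.Icc (0 : ℝ) 1, ENNReal.ofReal (sigma (γ t) * ‖deriv γ t‖) := by
  refine MeasureTheory.setLIntegral_congr_fun measurableSet_Icc fun t ht => ?_
  have hs := (sigma_pos (hγ t ht)).le
  rw [h _ (hγ t ht), ← normSq_apply, ← Complex.sq_norm, ← mul_pow,
    Real.sqrt_sq (mul_nonneg hs (norm_nonneg _))]

/-- A function that is `1`-Lipschitz infinitesimally is so for the induced distance. -/
lemma norm_sub_le_inducedDist (h : IsHyperbolicOnDisk X) {V : Type*} [NormedAddCommGroup V]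
    [NormedSpace ℝ V] [CompleteSpace V] {ψ : ℂ → V} (hψ : ContDiffOn ℝ 1 ψ disk)
    (hψ' : ∀ z ∈ disk, ∀ v, ‖fderiv ℝ ψ z v‖ ≤ sigma z * ‖v‖) (p q : ℂ) :
    ENNReal.ofReal ‖ψ q - ψ p‖ ≤ inducedDist disk X p q := by
  refine le_iInf ?_
  rintro ⟨γ, hγ, rfl, rfl, hmem⟩
  have huIcc : Set.uIcc (0 : ℝ) 1 = Set.Icc 0 1 := Set.uIcc_of_le zero_le_one
  have hd : ∀ t ∈ Set.uIcc (0 : ℝ) 1,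
      HasDerivAt (fun t => ψ (γ t)) (fderiv ℝ ψ (γ t) (deriv γ t)) t := by
    intro t ht
    have h1 := (hψ.contDiffAt (isOpen_disk.mem_nhds (hmem t (huIcc ▸ ht)))).differentiableAt
      (by norm_num)
    exact h1.hasFDerivAt.comp_hasDerivAt t (hγ.differentiable (by norm_num) t).hasDerivAt
  have hcont : ContinuousOn (fun t => fderiv ℝ ψ (γ t) (deriv γ t)) (Set.uIcc 0 1) := by
    refine ContinuousOn.clm_apply ?_ (hγ.continuous_deriv (by norm_num)).continuousOn
    exact (hψ.continuousOn_fderiv_of_isOpen isOpen_disk (by norm_num)).comp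
      hγ.continuous.continuousOn fun t ht => hmem t (huIcc ▸ ht)
  rw [h.inducedLength_eq hmem, ← intervalIntegral.integral_eq_sub_of_hasDerivAt hd
    hcont.intervalIntegrable, intervalIntegral.integral_of_le zero_le_one, ofReal_norm]
  refine (MeasureTheory.enorm_integral_le_lintegral_enorm _).trans ?_
  refine (MeasureTheory.lintegral_mono_set Set.Ioc_subset_Icc_self).trans ?_
  refine MeasureTheory.setLIntegral_mono' measurableSet_Icc fun t ht => ?_
  rw [← ofReal_norm]
  exact ENNReal.ofReal_le_ofReal (hψ' _ (hmem t ht) _)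

lemma inducedDist_le (h : IsHyperbolicOnDisk X) {r : ℝ} (hr0 : 0 ≤ r) (hr : r < 1) {p q : ℂ}
    (hp : ‖p‖ ≤ r) (hq : ‖q‖ ≤ r) :
    inducedDist disk X p q ≤ ENNReal.ofReal (2 / (1 - r ^ 2) * ‖p - q‖) := by
  let γ : ℝ → ℂ := fun t => p + t * (q - p)
  have hr2 : 0 < 1 - r ^ 2 := by nlinarith
  have hγd : ∀ t, HasDerivAt γ (q - p) t := fun t => by
    change HasDerivAt (fun t : ℝ => p + (t : ℂ) * (q - p)) _ t
    simpa using ((hasDerivAt_id t).ofReal_comp.mul_const (q - p)).const_add p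
  have hγc : ContDiff ℝ 1 γ :=
    contDiff_const.add (ofRealCLM.contDiff.mul contDiff_const)
  have hball : ∀ t ∈ Set.Icc (0 : ℝ) 1, ‖γ t‖ ≤ r := by
    intro t ht
    have : γ t = (1 - t : ℝ) * p + (t : ℝ) * q := by
      simp only [γ]
      push_cast
      ring
    rw [this]
    refine (norm_add_le _ _).trans ?_
    rw [norm_mul, norm_mul, Complex.norm_real, Complex.norm_real, Real.norm_of_nonneg ht.1,
      Real.norm_of_nonneg (sub_nonneg.2 ht.2)]
    nlinarith [ht.1, ht.2]
  have hmem : ∀ t ∈ Set.Icc (0 : ℝ) 1, γ t ∈ disk := fun t ht =>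
    mem_disk_iff.2 ((hball t ht).trans_lt hr)
  refine (iInf_le _ ⟨γ, hγc, by simp [γ], by simp [γ], hmem⟩).trans ?_
  rw [h.inducedLength_eq hmem]
  calc _ ≤ ∫⁻ _ in Set.Icc (0 : ℝ) 1, ENNReal.ofReal (2 / (1 - r ^ 2) * ‖p - q‖) := by
        refine MeasureTheory.setLIntegral_mono' measurableSet_Icc fun t ht => ?_
        rw [(hγd t).deriv, norm_sub_rev]
        refine ENNReal.ofReal_le_ofReal (mul_le_mul_of_nonneg_right ?_ (norm_nonneg _))
        rw [sigma]
        have := hball t ht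
        gcongr
    _ = _ := by simp

lemma isCompleteOn (h : IsHyperbolicOnDisk X) : IsCompleteOn disk X := by
  intro p hp hC
  have hσ : ∀ z ∈ disk, 1 ≤ sigma z := fun z hz => by
    rw [sigma, le_div_iff₀ (one_sub_norm_sq_pos hz)]
    nlinarith [sq_nonneg ‖z‖]
  have hE : ∀ a b : ℂ, ENNReal.ofReal ‖b - a‖ ≤ inducedDist disk X a b :=
    h.norm_sub_le_inducedDist (ψ := fun z => z) contDiffOn_id fun z hz v => by
      simpa using le_mul_of_one_le_left (norm_nonneg v) (hσ z hz)
  have hL : ∀ a b : ℂ, ENNReal.ofReal ‖Real.log (1 - ‖b‖ ^ 2) - Real.log (1 - ‖a‖ ^ 2)‖ ≤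
      inducedDist disk X a b := by
    refine h.norm_sub_le_inducedDist (ψ := fun z => Real.log (1 - ‖z‖ ^ 2)) ?_ fun z hz v => ?_
    · exact (contDiff_const.sub (contDiff_norm_sq ℝ)).contDiffOn.log
        fun z hz => (one_sub_norm_sq_pos hz).ne'
    · have hN := one_sub_norm_sq_pos hz
      rw [((hasFDerivAt_one_sub_norm_sq z).log hN.ne').fderiv]
      have h1 := abs_real_inner_le_norm z v
      have h2 : ‖z‖ * ‖v‖ ≤ ‖v‖ :=
        mul_le_of_le_one_left (norm_nonneg v) (mem_disk_iff.1 hz).le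
      simp only [smul_apply, neg_apply, innerSL_apply_apply, smul_eq_mul, norm_mul, norm_neg,
        norm_inv, Real.norm_eq_abs, abs_of_pos hN, abs_two, sigma]
      rw [div_mul_eq_mul_div, inv_mul_eq_div]
      gcongr
      linarith
  obtain ⟨N, hN⟩ := hC 1 one_pos
  set δ := Real.exp (Real.log (1 - ‖p N‖ ^ 2) - 1) with hδ
  have hδ0 : 0 < δ := Real.exp_pos _
  have hbd : ∀ n ≥ N, ‖p n‖ ^ 2 ≤ 1 - δ := by
    intro n hn
    have h1 := (hL (p N) (p n)).trans_lt (hN N le_rfl n hn)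
    rw [ENNReal.ofReal_lt_one, Real.norm_eq_abs, abs_lt] at h1
    have h2 : δ ≤ 1 - ‖p n‖ ^ 2 := by
      rw [← Real.exp_log (one_sub_norm_sq_pos (hp n)), hδ]
      exact Real.exp_le_exp.2 (by linarith)
    linarith
  have hδ1 : 0 ≤ 1 - δ := (sq_nonneg _).trans (hbd N le_rfl)
  set r := Real.sqrt (1 - δ) with hr
  have hr1 : r < 1 := by
    rw [hr, Real.sqrt_lt' one_pos]
    linarith
  have hbd' : ∀ n ≥ N, ‖p n‖ ≤ r := fun n hn => Real.le_sqrt_of_sq_le (hbd n hn)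
  have hcau : CauchySeq p := by
    refine Metric.cauchySeq_iff.2 fun ε hε => ?_
    obtain ⟨M, hM⟩ := hC (ENNReal.ofReal ε) (ENNReal.ofReal_pos.2 hε)
    refine ⟨M, fun m hm n hn => ?_⟩
    have := (hE (p n) (p m)).trans_lt (hM n hn m hm)
    rw [dist_eq_norm]
    exact (ENNReal.ofReal_lt_ofReal_iff hε).1 this
  obtain ⟨q, hq⟩ := cauchySeq_tendsto_of_complete hcau
  have hqr : ‖q‖ ≤ r := le_of_tendsto hq.norm (eventually_atTop.2 ⟨N, hbd'⟩)
  refine ⟨q, mem_disk_iff.2 (hqr.trans_lt hr1), ?_⟩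
  have hlim : Tendsto (fun n => ENNReal.ofReal (2 / (1 - r ^ 2) * ‖p n - q‖)) atTop (𝓝 0) := by
    have h1 : Tendsto (fun n => 2 / (1 - r ^ 2) * ‖p n - q‖) atTop (𝓝 0) := by
      simpa using ((hq.sub_const q).norm).const_mul (2 / (1 - r ^ 2))
    simpa using ENNReal.tendsto_ofReal h1
  refine tendsto_of_tendsto_of_tendsto_of_le_of_le' tendsto_const_nhds hlim
    (Eventually.of_forall fun n => zero_le) (eventually_atTop.2 ⟨N, fun n hn => ?_⟩)
  exact h.inducedDist_le (Real.sqrt_nonneg _) hr1 (hbd' n hn) hqr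

end IsHyperbolicOnDisk

/-! ### The slice -/

lemma hasFDerivAt_slice (w : ℂ) :
    HasFDerivAt slice ((ContinuousLinearMap.id ℝ ℂ).prod 0) w :=
  (hasFDerivAt_id w).prodMk (hasFDerivAt_const 0 w)

lemma pd_slice (a w : ℂ) : pd a slice w = (a, 0) := by
  rw [pd, (hasFDerivAt_slice w).fderiv]
  rfl

lemma isHyperbolicOnDisk_slice : IsHyperbolicOnDisk slice := by
  intro w _ a c
  simp [induced, pd_slice, metric_eq, slice]

lemma fst_eq_zero_of_isNormalTo_slice {w : ℂ} (hw : w ∈ disk) {n : ℂ × ℝ}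
    (hn : IsNormalTo slice w n) : n.1 = 0 := by
  have h1 := hn n.1
  have hs : sigma (slice w).1 ≠ 0 := (sigma_pos hw).ne'
  rw [pd_slice, metric_eq, mul_zero, add_zero, ← normSq_apply] at h1
  exact normSq_eq_zero.1 ((mul_eq_zero.1 h1).resolve_left (pow_ne_zero 2 hs))

lemma isConformalMinimalImmersionOn_slice : IsConformalMinimalImmersionOn disk slice := by
  refine ⟨⟨(contDiff_id.prodMk contDiff_const).contDiffOn, fun w hw => hw, fun w hw =>
    isHyperbolicOnDisk_slice.injective_fderiv hw⟩, isHyperbolicOnDisk_slice.isConformalOn, ?_⟩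
  intro w hw n hn
  have h1 := fst_eq_zero_of_isNormalTo_slice hw hn
  have h2 : ∀ a b, (covDeriv slice a b w).2 = 0 := by
    intro a b
    have : pd b (fun p => (slice p).2) = fun _ => (0 : ℝ) := by
      funext p
      simp [pd, slice]
    simp only [covDeriv, this]
    simp [pd]
  simp [meanCurvature, metric_eq, h1, h2]

lemma unitNormal_slice {w : ℂ} (hw : w ∈ disk) {n : ℂ × ℝ} (hn : IsUnitNormal slice w n) :
    n.2 = 1 ∨ n.2 = -1 := by
  have h1 := fst_eq_zero_of_isNormalTo_slice hw hn.1
  have h2 := hn.2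
  rw [metric_eq, h1] at h2
  simpa [mul_self_eq_one_iff] using h2

/-! ### Vertical normals and the Hopf differential -/

lemma pd_snd_eq_zero_of_vertical_normal {X : ℂ → ℂ × ℝ} {w : ℂ} (hw : (X w).1 ∈ disk) {n : ℂ × ℝ}
    (hn : IsUnitNormal X w n) (hv : n.2 = 1 ∨ n.2 = -1) (a : ℂ) : (pd a X w).2 = 0 := by
  have h2 : n.2 * n.2 = 1 := mul_self_eq_one_iff.2 hv
  have h3 := hn.2
  rw [metric_eq, h2, ← normSq_apply, add_eq_right, mul_eq_zero] at h3
  have h4 : n.1 = 0 := normSq_eq_zero.1 (h3.resolve_left (pow_ne_zero 2 (sigma_pos hw).ne'))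
  have h5 := hn.1 a
  rw [metric_eq, h4] at h5
  have h6 : n.2 ≠ 0 := fun h => by simp [h] at h2
  simpa [h6] using h5

lemma pd_conj {h : ℂ → ℂ} {w : ℂ} (hh : DifferentiableAt ℝ h w) (a : ℂ) :
    pd a (fun p => starRingEnd ℂ (h p)) w = starRingEnd ℂ (pd a h w) := by
  have : fderiv ℝ (fun p => starRingEnd ℂ (h p)) w = _ :=
    (conjCLE.toContinuousLinearMap.hasFDerivAt.comp w hh.hasFDerivAt).fderiv
  rw [pd, this]
  rfl

/-- A conformal immersion is horizontal at the zeros of its Hopf differential. -/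
lemma pd_snd_eq_zero_of_hopf_eq_zero {X : ℂ → ℂ × ℝ} {w : ℂ} (hX : DifferentiableAt ℝ X w)
    (hEG : coeffE X w = coeffG X w) (hF : coeffF X w = 0)
    (h0 : hopf (fun p => (X p).1) w = 0) (a : ℂ) : (pd a X w).2 = 0 := by
  simp only [hopf, dW, pd_conj hX.fst, ← fst_comp hX] at h0
  simp only [coeffE, coeffG, coeffF, induced, metric_eq] at hEG hF
  have hre := congrArg re h0
  have him := congrArg im h0
  rw [← Complex.ofReal_pow, mul_assoc, Complex.re_ofReal_mul] at hre
  rw [← Complex.ofReal_pow, mul_assoc, Complex.im_ofReal_mul] at him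
  rw [show (1 / 2 : ℂ) = ((1 / 2 : ℝ) : ℂ) by norm_num] at hre him
  simp only [mul_re, mul_im, sub_re, sub_im, conj_re, conj_im, I_re, I_im, ofReal_re, ofReal_im,
    zero_re, zero_im] at hre him
  have key : ∀ a, (pd a X w).2 = a.re * (pd 1 X w).2 + a.im * (pd I X w).2 := fun a => by
    rw [pd_eq a]
    simp
  rw [key a]
  generalize sigma (X w).1 ^ 2 = s at *
  generalize pd 1 X w = α at *
  generalize pd I X w = β at *
  have h1 : α.2 * α.2 = β.2 * β.2 := by linear_combination hEG - 4 * hre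
  have h2 : α.2 * β.2 = 0 := by linear_combination hF + 2 * him
  have h3 : α.2 = 0 := by
    rcases mul_eq_zero.1 h2 with h | h
    · exact h
    · rw [h, mul_zero] at h1
      exact mul_self_eq_zero.1 h1
  have h4 : β.2 = 0 := by
    rw [h3, mul_zero] at h1
    exact mul_self_eq_zero.1 h1.symm
  rw [h3, h4, mul_zero, mul_zero, add_zero]

lemma hopf_slice (w : ℂ) : hopf (fun p => (slice p).1) w = 0 := by
  have h1 : ∀ a : ℂ, pd a (fun p => starRingEnd ℂ (slice p).1) w = starRingEnd ℂ a := fun a => by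
    rw [pd_conj (hasFDerivAt_slice w).differentiableAt.fst,
      ← fst_comp (hasFDerivAt_slice w).differentiableAt, pd_slice]
  simp [hopf, dW, h1]

lemma not_areAssociateOn_slice {X : ℂ → ℂ × ℝ} {w a : ℂ} (hw : w ∈ disk)
    (hX : DifferentiableAt ℝ X w) (hconf : IsConformalOn disk X) (ha : (pd a X w).2 ≠ 0) :
    ¬ AreAssociateOn disk X slice := by
  rintro ⟨-, θ, hθ⟩
  have h1 := hθ w hw
  rw [hopf_slice] at h1
  exact ha (pd_snd_eq_zero_of_hopf_eq_zero hX (hconf w hw).1 (hconf w hw).2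
    ((mul_eq_zero.1 h1.symm).resolve_left (Complex.exp_ne_zero _)) a)

end HypProd

end

theorem mainTheorem7 (d : ℝ) (hd : 0 < d) :
    -- the screw motion surface `T`: a minimal embedding with metric `ds² + U² dτ²`, `K = -1`
    (HypProd.IsImmersionOn Set.univ (HypProd.screwSurface d) ∧
      HypProd.IsMinimalOn Set.univ (HypProd.screwSurface d) ∧
      Topology.IsEmbedding (HypProd.screwSurface d) ∧
      (∀ w : ℂ, HypProd.coeffE (HypProd.screwSurface d) w = 1 ∧
        HypProd.coeffF (HypProd.screwSurface d) w = 0 ∧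
        HypProd.coeffG (HypProd.screwSurface d) w = HypProd.screwU d w.re ^ 2) ∧
      (∀ w : ℂ, HypProd.gaussCurvature (HypProd.screwSurface d) w = -1) ∧
      (∀ α : ℝ, HypProd.screwMotion 1 α '' Set.range (HypProd.screwSurface d) =
        Set.range (HypProd.screwSurface d))) ∧
    -- the slice `Y`
    (HypProd.IsConformalMinimalImmersionOn HypProd.disk HypProd.slice ∧
      HypProd.IsCompleteOn HypProd.disk HypProd.slice ∧
      (∀ w ∈ HypProd.disk, HypProd.gaussCurvature HypProd.slice w = -1) ∧
      (∀ w ∈ HypProd.disk, ∀ n, HypProd.IsUnitNormal HypProd.slice w n → n.2 = 1 ∨ n.2 = -1)) ∧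
    -- the conformal parametrization `X` of the surface `T` by the hyperbolic disk
    ∃ X : ℂ → ℂ × ℝ,
      HypProd.IsConformalMinimalImmersionOn HypProd.disk X ∧
      Set.InjOn X HypProd.disk ∧
      X '' HypProd.disk = Set.range (HypProd.screwSurface d) ∧
      (∀ w ∈ HypProd.disk, HypProd.coeffE X w = HypProd.sigma w ^ 2 ∧
        HypProd.coeffF X w = 0 ∧ HypProd.coeffG X w = HypProd.sigma w ^ 2) ∧
      HypProd.IsCompleteOn HypProd.disk X ∧
      (∀ w ∈ HypProd.disk, HypProd.gaussCurvature X w = -1) ∧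
      (∀ w ∈ HypProd.disk, ∀ n, HypProd.IsUnitNormal X w n → n.2 ≠ 1 ∧ n.2 ≠ -1) ∧
      HypProd.AreIsometricOn HypProd.disk X HypProd.slice ∧
      ¬ HypProd.AreAssociateOn HypProd.disk X HypProd.slice := by
  have hX : HypProd.IsHyperbolicOnDisk (HypProd.screwDisk d) := fun w hw a c =>
    HypProd.induced_screwDisk hd hw a c
  have hY := HypProd.isHyperbolicOnDisk_slice
  refine ⟨⟨HypProd.isImmersionOn_screwSurface hd, HypProd.isMinimalOn_screwSurface hd,
    HypProd.isEmbedding_screwSurface hd, fun w => ⟨HypProd.coeffE_screwSurface hd w,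
      HypProd.coeffF_screwSurface hd w, HypProd.coeffG_screwSurface hd w⟩,
    HypProd.gaussCurvature_screwSurface hd, HypProd.screwMotion_image_range hd⟩,
    ⟨HypProd.isConformalMinimalImmersionOn_slice, hY.isCompleteOn,
      fun w hw => hY.gaussCurvature_eq hw, fun w hw n hn => HypProd.unitNormal_slice hw hn⟩,
    HypProd.screwDisk d,
    ⟨⟨HypProd.contDiffOn_screwDisk hd, fun w hw => HypProd.screwDisk_mem_disk hd hw,
      fun w hw => hX.injective_fderiv hw⟩, hX.isConformalOn, HypProd.isMinimalOn_screwDisk hd⟩,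
    HypProd.screwDisk_injOn hd, HypProd.screwDisk_image hd,
    fun w hw => ⟨hX.coeffE_eq hw, hX.coeffF_eq hw, hX.coeffG_eq hw⟩, hX.isCompleteOn,
    fun w hw => hX.gaussCurvature_eq hw, fun w hw n hn => ?_, hX.areIsometricOn hY, ?_⟩
  · obtain ⟨a, ha⟩ := HypProd.exists_pd_screwDisk_snd_ne_zero hd hw
    exact not_or.1 fun h => ha (HypProd.pd_snd_eq_zero_of_vertical_normal
      (HypProd.screwDisk_mem_disk hd hw) hn h a)
  · have h0 : (0 : ℂ) ∈ HypProd.disk := by simp [HypProd.disk]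
    obtain ⟨a, ha⟩ := HypProd.exists_pd_screwDisk_snd_ne_zero hd h0
    exact HypProd.not_areAssociateOn_slice h0
      (((HypProd.contDiffOn_screwDisk hd).contDiffAt
        (HypProd.isOpen_disk.mem_nhds h0)).differentiableAt (by norm_num)) hX.isConformalOn ha
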